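/- Consider an $M|G|1$ queue with Poisson arrivals of rate $\lambda>0$ and i.i.d. nonnegative service times with mean $1/\mu\in(0,\infty)$ and finite second moment $K/\mu^2$, independent of the arrivals, where $\rho=\lambda/\mu<1$. There are two priority classes, premium and ordinary; the server is work-conserving, premium customers preempt ordinary ones, preempted service is resumed where it was interrupted, and within a class service is first come, first served. Every customer joins the premium class independently with probability $\phi\in[0,1]$, and the premium class costs a fee $C\in\mathbb R$. Let $E[W_p](\phi)$ and $E[W_o](\phi)$ be the steady-state expected waiting times in queue (time in the system and not in service) of a customer who chooses the premium, respectively the ordinary, class: the limits, as $n\to\infty$, of the expected waiting time of the $n$-th customer if it chooses that class, in a queue that starts empty. Let $E[W](\phi)=\phi E[W_p](\phi)+(1-\phi)E[W_o](\phi)$. A value $\phi$ is an equilibrium if $E[W_p](\phi)+C\le E[W_o](\phi)$ whenever $\phi>0$, and $E[W_o](\phi)\le E[W_p](\phi)+C$ whenever $\phi<1$. Let $E$ be the set of equilibria, and $$PoA=\frac{\max_{\phi\in E}E[W](\phi)}{\min_{\phi\in[0,1]}E[W](\phi)}.$$ Then the expected waiting times $E[W_p](\phi)$ and $E[W_o](\phi)$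 exist as finite limits, the maximum and the minimum are attained, the minimum is positive, and $PoA\le 4/3$ for every such queue (so for all $K$ and $\rho$) and every $C$. The bound is approached as $\rho\to0$ and $K\to\infty$: for every $\varepsilon>0$ there are $\rho_0>0$ and $K_0$ such that every such queue with $\rho<\rho_0$ and $K>K_0$ has $PoA>4/3-\varepsilon$ for some fee $C>0$. Hence the bound is tight: $4/3$ is the supremum of $PoA$ over all such queues and all fees $C>0$. -/

import Mathlib

open MeasureTheory ProbabilityTheory Filter Topology

noncomputable section

/-! ### Sample-path dynamics of a two-class preemptive-resume single-server queue

The customers `0, 1, 2, …` arrive in this order at a queue that is empty before the arrival of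
customer `0`. `gap m` is the time between the arrivals of customers `m` and `m + 1`, `service n`
is the service requirement of customer `n`, and `premium n` says whether customer `n` belongs to
the premium class (`true`) or to the ordinary class (`false`). -/

namespace PRQueue

/-- Customer `i` has priority over customer `j`: premium customers go before ordinary ones, and
within a class the order is first come, first served. -/
abbrev HasPriority (premium : ℕ → Bool) (i j : ℕ) : Prop :=
  (premium i = true ∧ premium j = false) ∨ (premium i = premium j ∧ i < j)

/-- The remaining service requirement of customer `j` immediately after the arrival of
customer `m` (and `0` if customer `j` has not arrived yet). During the following interval of
length `gap m` there is no arrival, and the server, which never idles while work is present and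
always serves the present customer of highest priority, gives to customer `j` whatever is left of
the interval once the remaining work of all customers with priority over `j` is done, up to the
remaining requirement of `j`. A preempted customer keeps its remaining requirement. -/
def remaining (gap service : ℕ → ℝ) (premium : ℕ → Bool) : ℕ → ℕ → ℝ
  | 0, j => if j = 0 then service 0 else 0
  | m + 1, j =>
      if j = m + 1 then service (m + 1)
      else
        remaining gap service premium m j -
          min (remaining gap service premium m j)
            (max 0 (gap m -
              ∑ i ∈ (Finset.range (m + 1)).filter (fun i => HasPriority premium i j),
                remaining gap service premium m i))

/-- The work that is to be done before customer `n`, immediately after the arrival of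
customer `m`: the total remaining requirement of the customers that have arrived by then and
have priority over `n`. -/
def workAhead (gap service : ℕ → ℝ) (premium : ℕ → Bool) (m n : ℕ) : ℝ :=
  ∑ i ∈ (Finset.range (m + 1)).filter (fun i => HasPriority premium i n),
    remaining gap service premium m i

/-- Customer `n` is in the system immediately after the arrival of customer `m`: it has arrived,
and none of the intervals in between was long enough to complete it. -/
def InSystem (gap service : ℕ → ℝ) (premium : ℕ → Bool) (m n : ℕ) : Prop :=
  n ≤ m ∧ ∀ k, n ≤ k → k < m →
    gap k < workAhead gap service premium k n + remaining gap service premium k n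

open Classical in
/-- The waiting time in queue of customer `n`: the total time during which it is in the system
and not in service. In the interval after the arrival of customer `m` it waits until the work
ahead of it is done or until the interval ends, whichever is first. -/
def wait (gap service : ℕ → ℝ) (premium : ℕ → Bool) (n : ℕ) : ENNReal :=
  ∑' m, if InSystem gap service premium m n then
    ENNReal.ofReal (min (gap m) (workAhead gap service premium m n)) else 0

end PRQueue

/-- The data of a stable `M|G|1` queue: Poisson arrivals of rate `arrivalRate`, and a general
service time distribution `service` on `[0, ∞)` with positive mean and finite second moment. -/
structure MG1 where
  arrivalRate : ℝ
  service : Measure ℝ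
  isProbabilityMeasure_service : IsProbabilityMeasure service
  arrivalRate_pos : 0 < arrivalRate
  service_nonneg : ∀ᵐ s ∂service, 0 ≤ s
  memLp_service : MemLp id 2 service
  mean_pos : 0 < ∫ s, s ∂service
  load_lt_one : arrivalRate * ∫ s, s ∂service < 1

namespace MG1

/-- The service rate `μ`, the reciprocal of the mean service time. -/
def serviceRate (M : MG1) : ℝ := (∫ s, s ∂M.service)⁻¹

/-- The traffic load `ρ = λ / μ`. -/
def load (M : MG1) : ℝ := M.arrivalRate / M.serviceRate

/-- The variance parameter `K`: the second moment of service equals `K / μ ^ 2`. -/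
def varianceParam (M : MG1) : ℝ := (∫ s, s ^ 2 ∂M.service) * M.serviceRate ^ 2

/-- The law of the sequence of (interarrival time, service time, class) of the customers, when
every customer joins the premium class with probability `φ`: all these variables are independent,
interarrival times are exponential, service times have law `M.service`. -/
def law (M : MG1) (φ : unitInterval) : Measure (ℕ → ℝ × ℝ × Bool) :=
  Measure.infinitePi fun _ =>
    (expMeasure M.arrivalRate).prod (M.service.prod (bernoulliMeasure true false φ))

/-- The expected waiting time of customer `n` if that customer joins class `c` (`true` for
premium, `false` for ordinary), while all others join the premium class with probability `φ`. -/
def expectedWait (M : MG1) (φ : unitInterval) (c : Bool) (n : ℕ) : ENNReal :=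
  ∫⁻ ω, PRQueue.wait (fun k => (ω k).1) (fun k => (ω k).2.1)
    (Function.update (fun k => (ω k).2.2) n c) n ∂M.law φ

/-- The steady-state expected waiting time in class `c` when a fraction `φ` of the customers
joins the premium class: the limit of `expectedWait M φ c n` as `n → ∞` (defined as an upper
limit, and as `0` if that is infinite). -/
def meanWait (M : MG1) (φ : unitInterval) (c : Bool) : ℝ :=
  (limsup (M.expectedWait φ c) atTop).toReal

/-- The overall expected waiting time `E[W]`. -/
def overallMeanWait (M : MG1) (φ : unitInterval) : ℝ :=
  φ * M.meanWait φ true + (1 - φ) * M.meanWait φ false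

/-- `φ` is an equilibrium for the fee `C`: every choice of class that is made with positive
probability minimizes the expected cost (expected waiting time, plus `C` in the premium class),
given that the others join the premium class with probability `φ`. -/
def IsEquilibrium (M : MG1) (C : ℝ) (φ : unitInterval) : Prop :=
  (0 < φ → M.meanWait φ true + C ≤ M.meanWait φ false) ∧
    (φ < 1 → M.meanWait φ false ≤ M.meanWait φ true + C)

/-- `r` is the price of anarchy for the fee `C`: the ratio of the largest overall mean wait over
the equilibria, which has to be attained, to the smallest overall mean wait over all
`φ ∈ [0, 1]`, which has to be attained and positive. -/
def IsPriceOfAnarchy (M : MG1) (C r : ℝ) : Prop :=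
  ∃ a b : ℝ, IsGreatest (M.overallMeanWait '' {φ | M.IsEquilibrium C φ}) a ∧
    IsLeast (Set.range M.overallMeanWait) b ∧ 0 < b ∧ r = a / b

end MG1

end

noncomputable section

open scoped ENNReal

/-! ### Sample paths: reduction of one customer's view to a Lindley recursion -/

namespace PRQueue

section Dynamics

variable {gap service : ℕ → ℝ} {premium : ℕ → Bool}

/-! Everything rests on a closed form for the mean waits. Put `A = fcfsWait`, the wait without
priorities, `ρ = load`, `K = varianceParam`. Then the overall mean wait equals `A (1 + b t)` with `b
= 2/K - 1` and `t = φ(1-φ)(1-ρ)/(1-φρ)` (`overallMeanWait_eq`). Always `0 ≤ t ≤ 1/4`, and `K ≥ 1`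
gives `-1 < b ≤ 1`. If `b ≤ 0` all values lie between `3A/4` and `A`; if `b ≥ 0`, between `A` and
`5A/4`. So any two values have ratio at most `4/3` (`overallMeanWait_le`). Maximum and minimum are
attained by compactness, and equilibria exist by the intermediate value theorem. For sharpness take
the fee `A`: then `φ = 0` is an equilibrium with mean wait `A`, while at `φ = 1/2` the mean wait
tends to `3A/4` as `ρ → 0` and `K → ∞`.

The closed form comes from following one tagged customer. The work with priority over it evolves
like the workload of a single-class queue fed only by the customers ahead of it (`workAhead_eq`).
Before its arrival these are the premium customers if it is premium, and all customers if it is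
ordinary; afterwards only premium customers overtake an ordinary one. The workload found on arrival
has the Pollaczek-Khinchine mean (`tendsto_lindleyMoment_one`). From work `w` ahead, own requirement
`s` and overtaking load `σ`, the expected time to departure is `(w+s)/(1-σ)`, so the expected wait
is `(w+s)/(1-σ) - s = (w+σs)/(1-σ)`. This function solves a Poisson equation for the chain of (work
ahead, remaining requirement) killed at departure; `tsum_iterate_preemptOp` identifies the sum of
the expected waits with that solution. `expectedWait_eq` combines both steps. -/

theorem remaining_nonneg (hs : ∀ k, 0 ≤ service k) (m j : ℕ) :
    0 ≤ remaining gap service premium m j := by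
  induction m with
  | zero => rw [remaining]; split_ifs <;> simp [hs]
  | succ m ih =>
    rw [remaining]
    split_ifs
    · exact hs _
    · exact sub_nonneg.2 (min_le_left _ _)

/-- Serving a priority-closed set of present customers for a time `gap m` works off its total
remaining requirement at unit rate. -/
theorem sum_remaining_after_service (hs : ∀ k, 0 ≤ service k) {m : ℕ} (hg : 0 ≤ gap m)
    (H : Finset ℕ) (hH : H ⊆ Finset.range (m + 1))
    (hlow : ∀ i ∈ H, ∀ k ∈ Finset.range (m + 1), HasPriority premium k i → k ∈ H) :
    ∑ i ∈ H, (remaining gap service premium m i - min (remaining gap service premium m i)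
        (max 0 (gap m - ∑ k ∈ (Finset.range (m + 1)).filter (fun k => HasPriority premium k i),
          remaining gap service premium m k))) =
      max 0 (∑ i ∈ H, remaining gap service premium m i - gap m) := by
  -- Among the customers present, priority is a strict total order: premium ones are ranked by
  -- index, and ordinary ones are shifted by `m + 1` to come after all of them. Adding customers to
  -- the set in this order, the customers with priority over the newest are exactly those already in
  -- the set.
  have hrank : ∀ i ∈ Finset.range (m + 1), ∀ k ∈ Finset.range (m + 1),
      (HasPriority premium k i ↔ (if premium k then k else m + 1 + k) <
        (if premium i then i else m + 1 + i)) := by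
    intro i hi k hk
    rw [Finset.mem_range] at hi hk
    unfold HasPriority
    cases hpi : premium i <;> cases hpk : premium k <;> simp <;> omega
  induction H using Finset.induction_on_max_value
    (fun i => if premium i then i else m + 1 + i) with
  | empty => simp [hg]
  | insert a s ha hmax ih =>
    rw [Finset.insert_subset_iff] at hH
    have hs_low : ∀ i ∈ s, ∀ k ∈ Finset.range (m + 1), HasPriority premium k i → k ∈ s := by
      intro i hi k hk hki
      rcases Finset.mem_insert.1 (hlow i (Finset.mem_insert_of_mem hi) k hk hki) with rfl | h
      · exact absurd ((hrank i (hH.2 hi) k hk).1 hki) (not_lt.2 (hmax i hi))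
      · exact h
    have hset : (Finset.range (m + 1)).filter (fun k => HasPriority premium k a) = s := by
      ext k
      rw [Finset.mem_filter]
      constructor
      · rintro ⟨hk, hka⟩
        rcases Finset.mem_insert.1 (hlow a (Finset.mem_insert_self _ _) k hk hka) with rfl | h
        · exact absurd ((hrank k hk k hk).1 hka) (lt_irrefl _)
        · exact h
      · intro hk
        refine ⟨hH.2 hk, (hrank a hH.1 k (hH.2 hk)).2 (lt_of_le_of_ne (hmax k hk) ?_)⟩
        have hka : k ≠ a := fun h => ha (h ▸ hk)
        have h1 := Finset.mem_range.1 hH.1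
        have h2 := Finset.mem_range.1 (hH.2 hk)
        split_ifs <;> omega
    rw [Finset.sum_insert ha, Finset.sum_insert ha, ih hH.2 hs_low, hset]
    have hr := remaining_nonneg (gap := gap) (premium := premium) hs m a
    rcases le_total (∑ i ∈ s, remaining gap service premium m i) (gap m) with h | h
    · rw [max_eq_left (sub_nonpos.2 h), max_eq_right (sub_nonneg.2 h)]
      rcases le_total (remaining gap service premium m a)
        (gap m - ∑ i ∈ s, remaining gap service premium m i) with h' | h'
      · rw [min_eq_left h', max_eq_left (by linarith)]; ring
      · rw [min_eq_right h', max_eq_right (by linarith)]; ring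
    · rw [max_eq_right (sub_nonneg.2 h), max_eq_left (sub_nonpos.2 h), min_eq_right hr,
        max_eq_right (by linarith)]
      ring

/-- The workload found by the successive arrivals in a work-conserving queue, where customer `m`
brings the work `input m`. -/
def lindley (gap input : ℕ → ℝ) : ℕ → ℝ
  | 0 => 0
  | m + 1 => max 0 (lindley gap input m + input m - gap m)

/-- The work that has priority over customer `n`, brought by customer `m`. -/
def priorityInput (service : ℕ → ℝ) (premium : ℕ → Bool) (n m : ℕ) : ℝ :=
  if HasPriority premium m n then service m else 0

/-- By transitivity of priority, the customers ahead of `n` form a priority-closed set. The server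
therefore reduces their total work at unit rate, whatever the other customers bring. -/
theorem workAhead_eq (hs : ∀ k, 0 ≤ service k) (hg : ∀ k, 0 ≤ gap k) (m n : ℕ) :
    workAhead gap service premium m n =
      lindley gap (priorityInput service premium n) m + priorityInput service premium n m := by
  induction m with
  | zero =>
    simp only [workAhead, lindley, priorityInput, zero_add, Finset.range_one,
      Finset.sum_filter, Finset.sum_singleton, remaining, if_true]
  | succ m ih =>
    have key := sum_remaining_after_service (gap := gap) (premium := premium) hs (hg m)
      ((Finset.range (m + 1)).filter (fun i => HasPriority premium i n))
      (Finset.filter_subset _ _) (by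
        intro i hi k hk hki
        rw [Finset.mem_filter] at hi ⊢
        refine ⟨hk, ?_⟩
        obtain ⟨-, hi⟩ := hi
        unfold HasPriority at *
        rcases hki with ⟨h1, h2⟩ | ⟨h1, h2⟩ <;> rcases hi with ⟨h3, h4⟩ | ⟨h3, h4⟩ <;>
          (simp_all; try omega))
    rw [lindley, ← ih, workAhead, workAhead, ← key, Finset.sum_filter,
      Finset.sum_range_succ, ← Finset.sum_filter]
    congr 1
    · refine Finset.sum_congr rfl fun i hi => ?_
      have : i ≠ m + 1 := by
        have := Finset.mem_range.1 (Finset.mem_filter.1 hi).1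
        omega
      rw [remaining, if_neg this]
    · simp [priorityInput, remaining]

/-- The remaining requirement of customer `n` at the arrival of customer `n + k`. -/
def residual (gap service : ℕ → ℝ) (premium : ℕ → Bool) (n : ℕ) : ℕ → ℝ
  | 0 => service n
  | k + 1 => residual gap service premium n k - min (residual gap service premium n k)
      (max 0 (gap (n + k) - (lindley gap (priorityInput service premium n) (n + k) +
        priorityInput service premium n (n + k))))

theorem remaining_eq_residual (hs : ∀ k, 0 ≤ service k) (hg : ∀ k, 0 ≤ gap k) (n k : ℕ) :
    remaining gap service premium (n + k) n = residual gap service premium n k := by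
  induction k with
  | zero => cases n <;> simp [remaining, residual]
  | succ k ih =>
    rw [residual, ← ih, ← workAhead_eq hs hg, ← add_assoc, remaining, if_neg (by omega)]
    rfl

/-- Customer `n` is still in the system at the arrival of customer `n + k`. -/
def Present (gap service : ℕ → ℝ) (premium : ℕ → Bool) (n k : ℕ) : Prop :=
  ∀ j < k, gap (n + j) < lindley gap (priorityInput service premium n) (n + j) +
    priorityInput service premium n (n + j) + residual gap service premium n j

theorem inSystem_add_iff (hs : ∀ k, 0 ≤ service k) (hg : ∀ k, 0 ≤ gap k) (n k : ℕ) :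
    InSystem gap service premium (n + k) n ↔ Present gap service premium n k := by
  unfold InSystem Present
  constructor
  · rintro ⟨-, h⟩ j hj
    have := h (n + j) (by omega) (by omega)
    rwa [workAhead_eq hs hg, remaining_eq_residual hs hg] at this
  · refine fun h => ⟨by omega, fun j hj hjk => ?_⟩
    obtain ⟨i, rfl⟩ := Nat.exists_eq_add_of_le hj
    rw [workAhead_eq hs hg, remaining_eq_residual hs hg]
    exact h i (by omega)

open Classical in
-- Before its own arrival the customer is not in the system, so the first `n` terms vanish and the
-- sum can be reindexed from its arrival.
theorem wait_eq (hs : ∀ k, 0 ≤ service k) (hg : ∀ k, 0 ≤ gap k) (n : ℕ) :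
    wait gap service premium n = ∑' k, if Present gap service premium n k then
      ENNReal.ofReal (min (gap (n + k)) (lindley gap (priorityInput service premium n) (n + k) +
        priorityInput service premium n (n + k))) else 0 := by
  rw [wait, ← ENNReal.summable.sum_add_tsum_nat_add' (k := n), Finset.sum_eq_zero, zero_add]
  · refine tsum_congr fun k => ?_
    simp only [add_comm k n, inSystem_add_iff hs hg, workAhead_eq hs hg]
  · intro i hi
    rw [if_neg]
    rintro ⟨h, -⟩
    exact absurd (Finset.mem_range.1 hi) (not_lt.2 h)

theorem lindley_nonneg (gap input : ℕ → ℝ) (m : ℕ) : 0 ≤ lindley gap input m := by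
  cases m with
  | zero => exact le_rfl
  | succ m => exact le_max_left _ _

theorem lindley_congr {gap gap' input input' : ℕ → ℝ} {m : ℕ} (hg : ∀ k < m, gap k = gap' k)
    (hi : ∀ k < m, input k = input' k) : lindley gap input m = lindley gap' input' m := by
  induction m with
  | zero => rfl
  | succ m ih =>
    rw [lindley, lindley, ih (fun k hk => hg k (by omega)) (fun k hk => hi k (by omega)),
      hg m (by omega), hi m (by omega)]

end Dynamics

end PRQueue

/-! ### Resampling single coordinates of an i.i.d. sequence -/

/-- Resampling one coordinate of an i.i.d. sequence does not change its law. -/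
theorem lintegral_infinitePi_update {Z : Type*} [MeasurableSpace Z] (μ : Measure Z)
    [IsProbabilityMeasure μ] (m : ℕ) {F : (ℕ → Z) → ENNReal} (hF : Measurable F) :
    ∫⁻ ω, ∫⁻ z, F (Function.update ω m z) ∂μ ∂Measure.infinitePi (fun _ : ℕ => μ) =
      ∫⁻ ω, F ω ∂Measure.infinitePi (fun _ : ℕ => μ) := by
  have hmeas : Measurable (fun p : (ℕ → Z) × Z => Function.update p.1 m p.2) := by
    refine measurable_pi_iff.2 fun i => ?_
    by_cases h : i = m
    · subst h; simp only [Function.update_self]; fun_prop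
    · simp only [Function.update_of_ne h]
      fun_prop
  have hmap : ((Measure.infinitePi (fun _ : ℕ => μ)).prod μ).map
      (fun p : (ℕ → Z) × Z => Function.update p.1 m p.2) =
        Measure.infinitePi (fun _ : ℕ => μ) := by
    -- A product measure is determined by finite boxes. If the box constrains coordinate `m`, the
    -- fresh copy supplies that factor and the old coordinate becomes free.
    refine Measure.eq_infinitePi _ fun s t ht => ?_
    rw [Measure.map_apply hmeas (MeasurableSet.pi s.countable_toSet fun i _ => ht i)]
    by_cases hm : m ∈ s
    · have : (fun p : (ℕ → Z) × Z => Function.update p.1 m p.2) ⁻¹' (Set.pi s t) =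
          (Set.pi (s.erase m : Finset ℕ) t) ×ˢ t m := by
        ext ⟨ω, z⟩
        simp only [Set.mem_preimage, Set.mem_pi, Set.mem_prod, Finset.mem_coe, Finset.mem_erase]
        constructor
        · intro h
          refine ⟨fun i hi => ?_, by simpa using h m hm⟩
          simpa [Function.update_of_ne hi.1] using h i hi.2
        · rintro ⟨h, hz⟩ i hi
          by_cases him : i = m
          · subst him; simpa using hz
          · simpa [Function.update_of_ne him] using h i ⟨him, hi⟩
      rw [this, Measure.prod_prod, Measure.infinitePi_pi _ (fun i _ => ht i),
        Finset.prod_erase_mul _ _ hm]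
    · have : (fun p : (ℕ → Z) × Z => Function.update p.1 m p.2) ⁻¹' (Set.pi s t) =
          (Set.pi s t) ×ˢ Set.univ := by
        ext ⟨ω, z⟩
        simp only [Set.mem_preimage, Set.mem_pi, Set.mem_prod, Finset.mem_coe, Set.mem_univ,
          and_true]
        refine forall₂_congr fun i hi => ?_
        rw [Function.update_of_ne (ne_of_mem_of_not_mem hi hm)]
      rw [this, Measure.prod_prod, Measure.infinitePi_pi _ (fun i _ => ht i)]
      simp
  conv_rhs => rw [← hmap, lintegral_map hF hmeas]
  exact (lintegral_prod _ (hF.comp hmeas).aemeasurable).symm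

/-- Modifying one coordinate of an i.i.d. sequence in a way that preserves its law does not change
the law of the sequence. -/
theorem lintegral_infinitePi_update_map {Z Y : Type*} [MeasurableSpace Z] [MeasurableSpace Y]
    (μ : Measure Z) [IsProbabilityMeasure μ] (η : Measure Y) [SFinite η] {g : Z × Y → Z}
    (hg : Measurable g) (hmap : (μ.prod η).map g = μ) (m : ℕ) {F : (ℕ → Z) → ENNReal}
    (hF : Measurable F) :
    ∫⁻ ω, ∫⁻ y, F (Function.update ω m (g (ω m, y))) ∂η ∂Measure.infinitePi (fun _ : ℕ => μ) =
      ∫⁻ ω, F ω ∂Measure.infinitePi (fun _ : ℕ => μ) := by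
  have hmeas : Measurable (fun p : (ℕ → Z) × Y => Function.update p.1 m (g (p.1 m, p.2))) := by
    refine measurable_pi_iff.2 fun i => ?_
    by_cases h : i = m
    · subst h
      simp only [Function.update_self]
      fun_prop
    · simp only [Function.update_of_ne h]
      fun_prop
  have hmeas' (ω : ℕ → Z) : Measurable (fun z : Z => Function.update ω m z) :=
    measurable_update ω
  -- Coordinate `m` is first replaced by a fresh `z`. The pair of `z` and `y` then has the product
  -- law, which `g` carries to `μ`.
  refine (lintegral_infinitePi_update μ m (hF.comp hmeas).lintegral_prod_right').symm.trans ?_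
  rw [← lintegral_infinitePi_update μ m hF]
  refine lintegral_congr fun ω => ?_
  calc ∫⁻ z, ∫⁻ y, F (Function.update (Function.update ω m z) m
        (g (Function.update ω m z m, y))) ∂η ∂μ
      = ∫⁻ z, ∫⁻ y, F (Function.update ω m (g (z, y))) ∂η ∂μ := by simp
    _ = ∫⁻ p, F (Function.update ω m (g p)) ∂(μ.prod η) :=
        (lintegral_prod _ ((hF.comp (hmeas' ω)).comp hg).aemeasurable).symm
    _ = ∫⁻ z, F (Function.update ω m z) ∂((μ.prod η).map g) :=
        (lintegral_map (hF.comp (hmeas' ω)) hg).symm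
    _ = ∫⁻ z, F (Function.update ω m z) ∂μ := by rw [hmap]

/-! ### Integrals against the exponential law -/

theorem expMeasure_eq_withDensity (r : ℝ) :
    expMeasure r = volume.withDensity (exponentialPDF r) := rfl

theorem ae_nonneg_expMeasure (r : ℝ) : ∀ᵐ a ∂expMeasure r, 0 ≤ a := by
  rw [expMeasure_eq_withDensity, ae_iff]
  simp only [not_le]
  change volume.withDensity (exponentialPDF r) (Set.Iio 0) = 0
  rw [withDensity_apply _ measurableSet_Iio, lintegral_exponentialPDF_of_nonpos le_rfl]

/-- The expectation of a function that vanishes beyond `u ≥ 0`. -/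
theorem lintegral_expMeasure_Iio {r : ℝ} (hr : 0 < r) {u : ℝ} (hu : 0 ≤ u) {f : ℝ → ℝ}
    (hf : Continuous f) (hf0 : ∀ a, 0 ≤ a → a ≤ u → 0 ≤ f a) :
    ∫⁻ a, (Set.Iio u).indicator (fun a => ENNReal.ofReal (f a)) a ∂expMeasure r =
      ENNReal.ofReal (∫ a in (0)..u, f a * (r * Real.exp (-(r * a)))) := by
  have hpdf : Measurable (exponentialPDF r) :=
    (measurable_exponentialPDFReal r).ennreal_ofReal
  have hfm : Measurable (fun a => ENNReal.ofReal (f a)) := hf.measurable.ennreal_ofReal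
  rw [expMeasure_eq_withDensity, lintegral_withDensity_eq_lintegral_mul _ hpdf
    (hfm.indicator measurableSet_Iio)]
  have : (exponentialPDF r * (Set.Iio u).indicator (fun a => ENNReal.ofReal (f a))) =
      (Set.Ico 0 u).indicator
        (fun a => ENNReal.ofReal (f a * (r * Real.exp (-(r * a))))) := by
    ext a
    rw [Pi.mul_apply]
    by_cases h0 : 0 ≤ a
    · by_cases hau : a < u
      · rw [Set.indicator_of_mem (Set.mem_Iio.2 hau), Set.indicator_of_mem (Set.mem_Ico.2 ⟨h0, hau⟩),
          exponentialPDF_of_nonneg h0, ENNReal.ofReal_mul (hf0 a h0 hau.le), mul_comm]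
      · rw [Set.indicator_of_notMem (by simpa using hau), Set.indicator_of_notMem (by simp [hau])]
        simp
    · rw [exponentialPDF_of_neg (not_le.1 h0), Set.indicator_of_notMem
        (s := Set.Ico 0 u) (fun h => h0 h.1)]
      simp
  rw [this, lintegral_indicator measurableSet_Ico, intervalIntegral.integral_of_le hu,
    ← integral_Ico_eq_integral_Ioc, ofReal_integral_eq_lintegral_ofReal]
  · refine (Continuous.integrableOn_Icc ?_).mono_set Set.Ico_subset_Icc_self
    fun_prop
  · refine (ae_restrict_mem measurableSet_Ico).mono fun a ha => ?_
    have := hf0 a ha.1 ha.2.le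
    simp only [Pi.zero_apply]
    positivity

/-- The two integrands add up to the derivative of `-(u - a)^(k+1) exp(-r a)`, which vanishes at `a
= u`. -/
theorem integral_pow_sub_mul_exp (r : ℝ) (u : ℝ) (k : ℕ) :
    u ^ (k + 1) = (∫ a in (0)..u, (u - a) ^ (k + 1) * (r * Real.exp (-(r * a)))) +
      (∫ a in (0)..u, ((k + 1) * (u - a) ^ k) * Real.exp (-(r * a))) := by
  have hderiv : ∀ a ∈ Set.uIcc 0 u, HasDerivAt (fun a => -((u - a) ^ (k + 1) * Real.exp (-(r * a))))
      ((u - a) ^ (k + 1) * (r * Real.exp (-(r * a))) +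
        ((k + 1) * (u - a) ^ k) * Real.exp (-(r * a))) a := by
    intro a _
    have h1 : HasDerivAt (fun a : ℝ => u - a) (-1) a := (hasDerivAt_id a).const_sub u
    have h2 : HasDerivAt (fun a : ℝ => -(r * a)) (-r) a := by
      simpa using ((hasDerivAt_id' a).const_mul r).fun_neg
    refine ((h1.fun_pow (k + 1)).fun_mul h2.exp).fun_neg.congr_deriv ?_
    rw [Nat.add_sub_cancel]
    push_cast
    ring
  have h := intervalIntegral.integral_eq_sub_of_hasDerivAt hderiv
    (Continuous.intervalIntegrable (by fun_prop) _ _)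
  rw [intervalIntegral.integral_add (Continuous.intervalIntegrable (by fun_prop) _ _)
    (Continuous.intervalIntegrable (by fun_prop) _ _)] at h
  rw [h]
  simp

/-- The memoryless recursion for the moments of the work left after an exponential time. -/
theorem pow_eq_lintegral_expMeasure {r : ℝ} (hr : 0 < r) {u : ℝ} (hu : 0 ≤ u) (k : ℕ) :
    ENNReal.ofReal (u ^ (k + 1)) =
      ∫⁻ a, (Set.Iio u).indicator (fun a => ENNReal.ofReal ((u - a) ^ (k + 1))) a ∂expMeasure r +
      ENNReal.ofReal ((k + 1) / r) *
        ∫⁻ a, (Set.Iio u).indicator (fun a => ENNReal.ofReal ((u - a) ^ k)) a ∂expMeasure r := by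
  have h0 : ∀ j : ℕ, ∀ a, 0 ≤ a → a ≤ u → 0 ≤ (u - a) ^ j :=
    fun j a _ ha => pow_nonneg (sub_nonneg.2 ha) _
  rw [lintegral_expMeasure_Iio hr hu (by fun_prop) (h0 _),
    lintegral_expMeasure_Iio hr hu (by fun_prop) (h0 _), integral_pow_sub_mul_exp r u k,
    ← ENNReal.ofReal_mul (by positivity), ← ENNReal.ofReal_add]
  · congr 2
    rw [← intervalIntegral.integral_const_mul]
    congr 1
    ext a
    field_simp
  · refine intervalIntegral.integral_nonneg hu fun a ha => ?_
    have := h0 (k + 1) a ha.1 ha.2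
    positivity
  · refine mul_nonneg (by positivity) (intervalIntegral.integral_nonneg hu fun a ha => ?_)
    have := h0 k a ha.1 ha.2
    positivity

/-! ### Moments of the workload and the Pollaczek-Khinchine formula -/

section Lindley

variable {Z : Type*} [MeasurableSpace Z]

/-- The law of the workload found by the `n`-th arrival at a queue with Poisson arrivals of rate
`r` that starts empty, when the arrivals bring independent amounts of work distributed like `X`
under `ν`. -/
def lindleyLaw (r : ℝ) (ν : Measure Z) (X : Z → ℝ) : ℕ → Measure ℝ
  | 0 => Measure.dirac 0
  | n + 1 => ((lindleyLaw r ν X n).prod (ν.prod (expMeasure r))).map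
      (fun p => max 0 (p.1 + X p.2.1 - p.2.2))

variable {r : ℝ} {ν : Measure Z} {X : Z → ℝ}

theorem isProbabilityMeasure_lindleyLaw (hr : 0 < r) [IsProbabilityMeasure ν] (hX : Measurable X)
    (n : ℕ) : IsProbabilityMeasure (lindleyLaw r ν X n) := by
  have := isProbabilityMeasure_expMeasure hr
  induction n with
  | zero => exact Measure.dirac.isProbabilityMeasure
  | succ n ih => exact Measure.isProbabilityMeasure_map (by fun_prop)

theorem ae_nonneg_lindleyLaw (hX : Measurable X) (n : ℕ) :
    ∀ᵐ v ∂lindleyLaw r ν X n, 0 ≤ v := by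
  cases n with
  | zero => simp [lindleyLaw, ae_dirac_eq]
  | succ n =>
    rw [lindleyLaw, ae_map_iff (by fun_prop) measurableSet_Ici]
    exact ae_of_all _ fun p => le_max_left _ _

theorem lintegral_lindleyLaw_succ (hr : 0 < r) [IsProbabilityMeasure ν] (hX : Measurable X) (n : ℕ)
    {f : ℝ → ℝ≥0∞} (hf : Measurable f) :
    ∫⁻ v, f v ∂lindleyLaw r ν X (n + 1) =
      ∫⁻ v, ∫⁻ z, ∫⁻ a, f (max 0 (v + X z - a)) ∂expMeasure r ∂ν ∂lindleyLaw r ν X n := by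
  have := isProbabilityMeasure_expMeasure hr
  have := isProbabilityMeasure_lindleyLaw (ν := ν) hr hX n
  rw [lindleyLaw, lintegral_map hf (by fun_prop), lintegral_prod _ (by fun_prop)]
  refine lintegral_congr fun v => ?_
  rw [lintegral_prod _ (by fun_prop)]

theorem monotone_lindley_step (r : ℝ) (ν : Measure Z) (X : Z → ℝ) {f : ℝ → ℝ≥0∞}
    (hf : Monotone f) :
    Monotone fun v => ∫⁻ z, ∫⁻ a, f (max 0 (v + X z - a)) ∂expMeasure r ∂ν := fun v w hvw =>
  lintegral_mono fun z => lintegral_mono fun a => hf (max_le_max le_rfl (by linarith))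

/-- Started empty, the workload increases stochastically: it cannot drop below `0` in the first
step, and the transition operator preserves monotone functions. The induction therefore runs over
all monotone `f` at once. -/
theorem lintegral_lindleyLaw_mono (hr : 0 < r) [IsProbabilityMeasure ν] (hX : Measurable X)
    {f : ℝ → ℝ≥0∞} (hf : Monotone f) :
    Monotone fun n => ∫⁻ v, f v ∂lindleyLaw r ν X n := by
  have := isProbabilityMeasure_expMeasure hr
  refine monotone_nat_of_le_succ fun n => ?_
  induction n generalizing f with
  | zero =>
    rw [lintegral_lindleyLaw_succ hr hX _ hf.measurable]
    simp only [lindleyLaw, lintegral_dirac]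
    calc f 0 = ∫⁻ z : Z, ∫⁻ a : ℝ, f 0 ∂expMeasure r ∂ν := by simp
      _ ≤ _ := lintegral_mono fun z => lintegral_mono fun a => hf (le_max_left _ _)
  | succ n ih =>
    rw [lintegral_lindleyLaw_succ hr hX _ hf.measurable,
      lintegral_lindleyLaw_succ hr hX _ hf.measurable]
    exact ih (monotone_lindley_step r ν X hf)

theorem lintegral_lindleyLaw_le_of_le (hr : 0 < r) [IsProbabilityMeasure ν] {Y : Z → ℝ}
    (hX : Measurable X) (hY : Measurable Y) (hXY : ∀ z, X z ≤ Y z)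
    {f : ℝ → ℝ≥0∞} (hf : Monotone f) (n : ℕ) :
    ∫⁻ v, f v ∂lindleyLaw r ν X n ≤ ∫⁻ v, f v ∂lindleyLaw r ν Y n := by
  induction n generalizing f with
  | zero => exact le_rfl
  | succ n ih =>
    rw [lintegral_lindleyLaw_succ hr hX _ hf.measurable,
      lintegral_lindleyLaw_succ hr hY _ hf.measurable]
    refine le_trans ?_ (ih (monotone_lindley_step r ν Y hf))
    exact lintegral_mono fun v => lintegral_mono fun z => lintegral_mono fun a =>
      hf (max_le_max le_rfl (by linarith [hXY z]))

/-- This is `pow_eq_lintegral_expMeasure` at `u = v + X z`. The coefficient of the lower moment is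
the one for which the exponential gap drops out. -/
theorem lintegral_pow_lindleyLaw_succ (hr : 0 < r) [IsProbabilityMeasure ν] (hX : Measurable X)
    (hX0 : ∀ᵐ z ∂ν, 0 ≤ X z) (n k : ℕ) :
    ∫⁻ v, ENNReal.ofReal (v ^ (k + 2)) ∂lindleyLaw r ν X (n + 1) +
      ENNReal.ofReal ((k + 2) / r) * ∫⁻ v, ENNReal.ofReal (v ^ (k + 1)) ∂lindleyLaw r ν X (n + 1) =
      ∫⁻ v, ∫⁻ z, ENNReal.ofReal ((v + X z) ^ (k + 2)) ∂ν ∂lindleyLaw r ν X n := by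
  have := isProbabilityMeasure_expMeasure hr
  have := isProbabilityMeasure_lindleyLaw (ν := ν) hr hX n
  rw [lintegral_lindleyLaw_succ hr hX n (by fun_prop),
    lintegral_lindleyLaw_succ hr hX n (by fun_prop), ← lintegral_const_mul _ (by fun_prop),
    ← lintegral_add_left (by fun_prop)]
  refine lintegral_congr_ae ((ae_nonneg_lindleyLaw hX n).mono fun v hv => ?_)
  simp only
  rw [← lintegral_const_mul _ (by fun_prop), ← lintegral_add_left (by fun_prop)]
  refine lintegral_congr_ae (hX0.mono fun z hz => ?_)
  simp only
  have key := pow_eq_lintegral_expMeasure hr (add_nonneg hv hz) (k + 1)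
  have hind : ∀ j : ℕ, ∀ a, (Set.Iio (v + X z)).indicator
      (fun a => ENNReal.ofReal ((v + X z - a) ^ (j + 1))) a =
        ENNReal.ofReal (max 0 (v + X z - a) ^ (j + 1)) := by
    intro j a
    by_cases h : a < v + X z
    · rw [Set.indicator_of_mem (Set.mem_Iio.2 h), max_eq_right (by linarith)]
    · rw [Set.indicator_of_notMem (by simpa using h), max_eq_left (by linarith)]
      simp
  simp only [hind] at key
  rw [key]
  congr 3
  push_cast
  ring

/-- The `k`-th moment of the workload found by the `n`-th arrival. -/
def lindleyMoment (r : ℝ) (ν : Measure Z) (X : Z → ℝ) (k n : ℕ) : ℝ≥0∞ :=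
  ∫⁻ v, ENNReal.ofReal (v ^ k) ∂lindleyLaw r ν X n

theorem lindleyMoment_zero (r : ℝ) (ν : Measure Z) (X : Z → ℝ) (k : ℕ) :
    lindleyMoment r ν X (k + 1) 0 = 0 := by
  simp [lindleyMoment, lindleyLaw]

theorem lintegral_add_sq_lindleyLaw (hr : 0 < r) [IsProbabilityMeasure ν] (hX : Measurable X)
    (hX0 : ∀ᵐ z ∂ν, 0 ≤ X z) (n : ℕ) :
    lindleyMoment r ν X 2 (n + 1) + ENNReal.ofReal (2 / r) * lindleyMoment r ν X 1 (n + 1) =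
      lindleyMoment r ν X 2 n + 2 * (∫⁻ z, ENNReal.ofReal (X z) ∂ν) * lindleyMoment r ν X 1 n +
        ∫⁻ z, ENNReal.ofReal (X z ^ 2) ∂ν := by
  have := isProbabilityMeasure_lindleyLaw (ν := ν) hr hX n
  have h := lintegral_pow_lindleyLaw_succ hr hX hX0 n 0
  simp only [Nat.cast_zero, zero_add] at h
  rw [lindleyMoment, lindleyMoment, h, lindleyMoment, lindleyMoment,
    ← lintegral_const_mul _ (by fun_prop), ← lintegral_add_left (by fun_prop)]
  conv_rhs => rw [← mul_one (∫⁻ z, ENNReal.ofReal (X z ^ 2) ∂ν),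
    ← measure_univ (μ := lindleyLaw r ν X n), ← lintegral_const,
    ← lintegral_add_left (by fun_prop)]
  refine lintegral_congr_ae ((ae_nonneg_lindleyLaw hX n).mono fun v hv => ?_)
  simp only
  have : ∀ᵐ z ∂ν, ENNReal.ofReal ((v + X z) ^ 2) = ENNReal.ofReal (v ^ 2) +
      (2 * ENNReal.ofReal (v ^ 1)) * ENNReal.ofReal (X z) + ENNReal.ofReal (X z ^ 2) := by
    refine hX0.mono fun z hz => ?_
    rw [← ENNReal.ofReal_ofNat 2, ← ENNReal.ofReal_mul (by norm_num),
      ← ENNReal.ofReal_mul (by positivity), ← ENNReal.ofReal_add (by positivity) (by positivity),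
      ← ENNReal.ofReal_add (by positivity) (by positivity)]
    ring_nf
  rw [lintegral_congr_ae this, lintegral_add_left (by fun_prop), lintegral_add_left (by fun_prop),
    lintegral_const_mul _ (by fun_prop)]
  simp
  ring

theorem lintegral_add_cube_lindleyLaw (hr : 0 < r) [IsProbabilityMeasure ν] (hX : Measurable X)
    (hX0 : ∀ᵐ z ∂ν, 0 ≤ X z) (n : ℕ) :
    lindleyMoment r ν X 3 (n + 1) + ENNReal.ofReal (3 / r) * lindleyMoment r ν X 2 (n + 1) =
      lindleyMoment r ν X 3 n + 3 * (∫⁻ z, ENNReal.ofReal (X z) ∂ν) * lindleyMoment r ν X 2 n +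
        3 * (∫⁻ z, ENNReal.ofReal (X z ^ 2) ∂ν) * lindleyMoment r ν X 1 n +
        ∫⁻ z, ENNReal.ofReal (X z ^ 3) ∂ν := by
  have := isProbabilityMeasure_lindleyLaw (ν := ν) hr hX n
  have h := lintegral_pow_lindleyLaw_succ hr hX hX0 n 1
  rw [show ((1 : ℕ) : ℝ) + 2 = 3 by norm_num] at h
  norm_num only at h
  rw [lindleyMoment, lindleyMoment, h, lindleyMoment, lindleyMoment, lindleyMoment,
    ← lintegral_const_mul (3 * ∫⁻ z, ENNReal.ofReal (X z) ∂ν) (by fun_prop),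
    ← lintegral_const_mul (3 * ∫⁻ z, ENNReal.ofReal (X z ^ 2) ∂ν) (by fun_prop),
    ← lintegral_add_left (by fun_prop), ← lintegral_add_left (by fun_prop)]
  conv_rhs => rw [← mul_one (∫⁻ z, ENNReal.ofReal (X z ^ 3) ∂ν),
    ← measure_univ (μ := lindleyLaw r ν X n), ← lintegral_const,
    ← lintegral_add_left (by fun_prop)]
  refine lintegral_congr_ae ((ae_nonneg_lindleyLaw hX n).mono fun v hv => ?_)
  simp only
  have : ∀ᵐ z ∂ν, ENNReal.ofReal ((v + X z) ^ 3) = ENNReal.ofReal (v ^ 3) +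
      (3 * ENNReal.ofReal (v ^ 2)) * ENNReal.ofReal (X z) +
      (3 * ENNReal.ofReal (v ^ 1)) * ENNReal.ofReal (X z ^ 2) + ENNReal.ofReal (X z ^ 3) := by
    refine hX0.mono fun z hz => ?_
    rw [← ENNReal.ofReal_ofNat 3, ← ENNReal.ofReal_mul (by norm_num),
      ← ENNReal.ofReal_mul (by positivity), ← ENNReal.ofReal_mul (by positivity), ← ENNReal.ofReal_mul (by positivity),
      ← ENNReal.ofReal_add (by positivity) (by positivity),
      ← ENNReal.ofReal_add (by positivity) (by positivity),
      ← ENNReal.ofReal_add (by positivity) (by positivity)]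
    ring_nf
  rw [lintegral_congr_ae this, lintegral_add_left (by fun_prop), lintegral_add_left (by fun_prop),
    lintegral_add_left (by fun_prop),
    lintegral_const_mul _ (by fun_prop), lintegral_const_mul _ (by fun_prop)]
  simp
  ring

theorem lindleyMoment_mono (hr : 0 < r) [IsProbabilityMeasure ν] (hX : Measurable X)
    (k : ℕ) : Monotone (lindleyMoment r ν X k) := by
  -- Powers are not monotone on the whole line, so `v` is replaced by `max 0 v`, which agrees with
  -- it almost surely.
  have hmono : Monotone fun v : ℝ => ENNReal.ofReal (max 0 v ^ k) := fun v w hvw =>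
    ENNReal.ofReal_le_ofReal (pow_le_pow_left₀ (le_max_left _ _) (max_le_max le_rfl hvw) _)
  have heq : lindleyMoment r ν X k =
      fun n => ∫⁻ v, ENNReal.ofReal (max 0 v ^ k) ∂lindleyLaw r ν X n := by
    ext n
    refine lintegral_congr_ae ((ae_nonneg_lindleyLaw hX n).mono fun v hv => ?_)
    simp only [max_eq_right hv]
  rw [heq]
  exact lintegral_lindleyLaw_mono hr hX hmono

end Lindley

/-- Since `q` increases, the recursion gives `2/r * a (n+1) ≤ 2 x₁ a n + x₂`. Replacing `a n` by the
larger `a (n+1)` and solving gives the bound without any limit. -/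
theorem le_of_second_moment_recursion {r x₁ x₂ : ℝ} {a q : ℕ → ℝ} (hr : 0 < r) (hx₁ : 0 ≤ x₁)
    (hρ : r * x₁ < 1) (ha : Monotone a) (hq : Monotone q)
    (h : ∀ n, q (n + 1) + 2 / r * a (n + 1) = q n + 2 * x₁ * a n + x₂) (n : ℕ) :
    a n ≤ r * x₂ / (2 * (1 - r * x₁)) := by
  have h1 := h n
  have h2 := hq n.le_succ
  have h3 := ha n.le_succ
  rw [le_div_iff₀ (by linarith)]
  have h4 : r * (q (n + 1)) + 2 * a (n + 1) = r * (q n + 2 * x₁ * a n + x₂) := by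
    rw [← h1]; field_simp
  have h5 : r * x₁ * a n ≤ r * x₁ * a (n + 1) := mul_le_mul_of_nonneg_left h3 (by positivity)
  have h6 : r * q n ≤ r * q (n + 1) := mul_le_mul_of_nonneg_left h2 hr.le
  have h7 : a n * (1 - r * x₁) ≤ a (n + 1) * (1 - r * x₁) :=
    mul_le_mul_of_nonneg_right h3 (by linarith)
  nlinarith

/-- The argument of `le_of_second_moment_recursion`, one degree higher, bounds `q`. Hence `q`
converges, cancels from the limit of the second-moment recursion, and leaves a linear equation for
the limit of `a`. -/
theorem tendsto_of_third_moment_recursion {r x₁ x₂ x₃ : ℝ} {a q c : ℕ → ℝ} (hr : 0 < r)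
    (hx₁ : 0 ≤ x₁) (hx₂ : 0 ≤ x₂) (hρ : r * x₁ < 1) (ha : Monotone a) (hq : Monotone q)
    (hc : Monotone c)
    (h : ∀ n, q (n + 1) + 2 / r * a (n + 1) = q n + 2 * x₁ * a n + x₂)
    (h' : ∀ n, c (n + 1) + 3 / r * q (n + 1) = c n + 3 * x₁ * q n + 3 * x₂ * a n + x₃) :
    Tendsto a atTop (𝓝 (r * x₂ / (2 * (1 - r * x₁)))) := by
  set B := r * x₂ / (2 * (1 - r * x₁)) with hB
  have haB : ∀ n, a n ≤ B := le_of_second_moment_recursion hr hx₁ hρ ha hq h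
  have hqB : ∀ n, q n ≤ r * (3 * x₂ * B + x₃) / (3 * (1 - r * x₁)) := by
    intro n
    have h1 := h' n
    have h2 := hc n.le_succ
    have h3 := hq n.le_succ
    rw [le_div_iff₀ (by linarith)]
    have h4 : r * (c (n + 1)) + 3 * q (n + 1) =
        r * (c n + 3 * x₁ * q n + 3 * x₂ * a n + x₃) := by
      rw [← h1]; field_simp
    have h5 : r * x₁ * q n ≤ r * x₁ * q (n + 1) := mul_le_mul_of_nonneg_left h3 (by positivity)
    have h6 : r * c n ≤ r * c (n + 1) := mul_le_mul_of_nonneg_left h2 hr.le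
    have h7 : q n * (1 - r * x₁) ≤ q (n + 1) * (1 - r * x₁) :=
      mul_le_mul_of_nonneg_right h3 (by linarith)
    have h8 : r * x₂ * a n ≤ r * x₂ * B := mul_le_mul_of_nonneg_left (haB n) (by positivity)
    nlinarith
  have hA := tendsto_atTop_ciSup ha ⟨B, Set.forall_mem_range.2 haB⟩
  have hQ := tendsto_atTop_ciSup hq ⟨_, Set.forall_mem_range.2 hqB⟩
  set A := ⨆ n, a n
  set Q := ⨆ n, q n
  have hl : Tendsto (fun n => q (n + 1) + 2 / r * a (n + 1)) atTop (𝓝 (Q + 2 / r * A)) :=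
    ((tendsto_add_atTop_iff_nat 1).2 hQ).add (((tendsto_add_atTop_iff_nat 1).2 hA).const_mul _)
  have hr' : Tendsto (fun n => q (n + 1) + 2 / r * a (n + 1)) atTop (𝓝 (Q + 2 * x₁ * A + x₂)) := by
    simp only [h]
    exact (hQ.add (hA.const_mul _)).add_const _
  have heq := tendsto_nhds_unique hl hr'
  have : A = B := by
    rw [hB, eq_div_iff (by linarith)]
    field_simp at heq
    linarith
  rw [← this]
  exact hA

section Lindley

variable {Z : Type*} [MeasurableSpace Z] {r : ℝ} {ν : Measure Z} {X : Z → ℝ}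

/-- The recursion lives in `ℝ≥0∞`, so finiteness of its right-hand side at step `n` forces both
moments at step `n + 1` to be finite. -/
theorem lindleyMoment_ne_top_of_recursion (hr : 0 < r) {k : ℕ} {b : ℕ → ℝ≥0∞} {c : ℝ} (hc : 0 < c)
    (h : ∀ n, lindleyMoment r ν X (k + 2) (n + 1) +
      ENNReal.ofReal (c / r) * lindleyMoment r ν X (k + 1) (n + 1) = b n)
    (hb : ∀ n, lindleyMoment r ν X (k + 2) n ≠ ∞ → lindleyMoment r ν X (k + 1) n ≠ ∞ → b n ≠ ∞)
    (n : ℕ) : lindleyMoment r ν X (k + 2) n ≠ ∞ ∧ lindleyMoment r ν X (k + 1) n ≠ ∞ := by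
  induction n with
  | zero => simp [lindleyMoment_zero]
  | succ n ih =>
    have hbn := hb n ih.1 ih.2
    rw [← h n, ENNReal.add_ne_top] at hbn
    refine ⟨hbn.1, fun htop => hbn.2 ?_⟩
    rw [htop, ENNReal.mul_top]
    exact (ENNReal.ofReal_pos.2 (by positivity)).ne'

theorem lindleyMoment_two_one_ne_top (hr : 0 < r) [IsProbabilityMeasure ν] (hX : Measurable X)
    (hX0 : ∀ᵐ z ∂ν, 0 ≤ X z) {x₁ x₂ : ℝ}
    (h₁ : ∫⁻ z, ENNReal.ofReal (X z) ∂ν = ENNReal.ofReal x₁)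
    (h₂ : ∫⁻ z, ENNReal.ofReal (X z ^ 2) ∂ν = ENNReal.ofReal x₂) (n : ℕ) :
    lindleyMoment r ν X 2 n ≠ ∞ ∧ lindleyMoment r ν X 1 n ≠ ∞ := by
  refine lindleyMoment_ne_top_of_recursion (k := 0) hr two_pos
    (lintegral_add_sq_lindleyLaw hr hX hX0) (fun n hn hn' => ?_) n
  rw [h₁, h₂]
  finiteness

theorem toReal_lindleyMoment_recursion (hr : 0 < r) [IsProbabilityMeasure ν] (hX : Measurable X)
    (hX0 : ∀ᵐ z ∂ν, 0 ≤ X z) {x₁ x₂ : ℝ} (hx₁ : 0 ≤ x₁) (hx₂ : 0 ≤ x₂)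
    (h₁ : ∫⁻ z, ENNReal.ofReal (X z) ∂ν = ENNReal.ofReal x₁)
    (h₂ : ∫⁻ z, ENNReal.ofReal (X z ^ 2) ∂ν = ENNReal.ofReal x₂) (n : ℕ) :
    (lindleyMoment r ν X 2 (n + 1)).toReal + 2 / r * (lindleyMoment r ν X 1 (n + 1)).toReal =
      (lindleyMoment r ν X 2 n).toReal + 2 * x₁ * (lindleyMoment r ν X 1 n).toReal + x₂ := by
  have hfin := lindleyMoment_two_one_ne_top hr hX hX0 h₁ h₂
  have hr2 : 0 ≤ 2 / r := by positivity
  have h := lintegral_add_sq_lindleyLaw hr hX hX0 n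
  rw [h₁, h₂] at h
  have h := congrArg ENNReal.toReal h
  obtain ⟨h2, h1⟩ := hfin n
  obtain ⟨h2', h1'⟩ := hfin (n + 1)
  rw [ENNReal.toReal_add (by finiteness) (by finiteness),
    ENNReal.toReal_add (by finiteness) (by finiteness),
    ENNReal.toReal_add (by finiteness) (by finiteness)] at h
  simpa [ENNReal.toReal_mul, ENNReal.toReal_ofReal hr2, ENNReal.toReal_ofReal hx₁,
    ENNReal.toReal_ofReal hx₂] using h

theorem toReal_lindleyMoment_mono (hr : 0 < r) [IsProbabilityMeasure ν] (hX : Measurable X)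
    {k : ℕ} (hfin : ∀ n, lindleyMoment r ν X k n ≠ ∞) :
    Monotone fun n => (lindleyMoment r ν X k n).toReal := fun _ m hnm =>
  ENNReal.toReal_mono (hfin m) (lindleyMoment_mono hr hX k hnm)

/-- The Pollaczek-Khinchine bound for the expected workload found by the `n`-th arrival. -/
theorem toReal_lindleyMoment_one_le (hr : 0 < r) [IsProbabilityMeasure ν] (hX : Measurable X)
    (hX0 : ∀ᵐ z ∂ν, 0 ≤ X z) {x₁ x₂ : ℝ} (hx₁ : 0 ≤ x₁) (hx₂ : 0 ≤ x₂)
    (h₁ : ∫⁻ z, ENNReal.ofReal (X z) ∂ν = ENNReal.ofReal x₁)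
    (h₂ : ∫⁻ z, ENNReal.ofReal (X z ^ 2) ∂ν = ENNReal.ofReal x₂) (hρ : r * x₁ < 1) (n : ℕ) :
    (lindleyMoment r ν X 1 n).toReal ≤ r * x₂ / (2 * (1 - r * x₁)) := by
  have hfin := lindleyMoment_two_one_ne_top hr hX hX0 h₁ h₂
  exact le_of_second_moment_recursion hr hx₁ hρ
    (toReal_lindleyMoment_mono hr hX fun n => (hfin n).2)
    (toReal_lindleyMoment_mono hr hX fun n => (hfin n).1)
    (toReal_lindleyMoment_recursion hr hX hX0 hx₁ hx₂ h₁ h₂) n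

theorem tendsto_toReal_lindleyMoment_one_of_third_moment (hr : 0 < r) [IsProbabilityMeasure ν]
    (hX : Measurable X) (hX0 : ∀ᵐ z ∂ν, 0 ≤ X z) {x₁ x₂ x₃ : ℝ} (hx₁ : 0 ≤ x₁) (hx₂ : 0 ≤ x₂)
    (hx₃ : 0 ≤ x₃)
    (h₁ : ∫⁻ z, ENNReal.ofReal (X z) ∂ν = ENNReal.ofReal x₁)
    (h₂ : ∫⁻ z, ENNReal.ofReal (X z ^ 2) ∂ν = ENNReal.ofReal x₂)
    (h₃ : ∫⁻ z, ENNReal.ofReal (X z ^ 3) ∂ν = ENNReal.ofReal x₃) (hρ : r * x₁ < 1) :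
    Tendsto (fun n => (lindleyMoment r ν X 1 n).toReal) atTop
      (𝓝 (r * x₂ / (2 * (1 - r * x₁)))) := by
  have hfin := lindleyMoment_two_one_ne_top hr hX hX0 h₁ h₂
  have hfin3 : ∀ n, lindleyMoment r ν X 3 n ≠ ∞ := fun n =>
    (lindleyMoment_ne_top_of_recursion (k := 1) hr three_pos
      (lintegral_add_cube_lindleyLaw hr hX hX0) (fun n hn hn' => by
        have := (hfin n).2
        rw [h₁, h₂, h₃]
        finiteness) n).1
  refine tendsto_of_third_moment_recursion (x₃ := x₃) hr hx₁ hx₂ hρ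
    (toReal_lindleyMoment_mono hr hX fun n => (hfin n).2)
    (toReal_lindleyMoment_mono hr hX fun n => (hfin n).1)
    (toReal_lindleyMoment_mono hr hX hfin3)
    (toReal_lindleyMoment_recursion hr hX hX0 hx₁ hx₂ h₁ h₂) fun n => ?_
  have hr3 : 0 ≤ 3 / r := by positivity
  have h := lintegral_add_cube_lindleyLaw hr hX hX0 n
  rw [h₁, h₂, h₃] at h
  have h := congrArg ENNReal.toReal h
  obtain ⟨h2, h1⟩ := hfin n
  obtain ⟨h2', h1'⟩ := hfin (n + 1)
  have h3 := hfin3 n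
  have h3' := hfin3 (n + 1)
  rw [ENNReal.toReal_add (by finiteness) (by finiteness),
    ENNReal.toReal_add (by finiteness) (by finiteness),
    ENNReal.toReal_add (by finiteness) (by finiteness),
    ENNReal.toReal_add (by finiteness) (by finiteness)] at h
  simpa [ENNReal.toReal_mul, ENNReal.toReal_ofReal hr3, ENNReal.toReal_ofReal hx₁,
    ENNReal.toReal_ofReal hx₂, ENNReal.toReal_ofReal hx₃] using h

theorem tendsto_lintegral_min_pow (hX : Measurable X) (hX0 : ∀ᵐ z ∂ν, 0 ≤ X z) (k : ℕ) :
    Tendsto (fun M : ℕ => ∫⁻ z, ENNReal.ofReal (min (X z) M ^ k) ∂ν) atTop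
      (𝓝 (∫⁻ z, ENNReal.ofReal (X z ^ k) ∂ν)) := by
  refine lintegral_tendsto_of_tendsto_of_monotone (fun M => by fun_prop) ?_ ?_
  · refine hX0.mono fun z hz M N hMN => ENNReal.ofReal_le_ofReal (pow_le_pow_left₀ ?_ ?_ _)
    · exact le_min hz (Nat.cast_nonneg _)
    · exact min_le_min le_rfl (Nat.cast_le.2 hMN)
  · refine ae_of_all _ fun z => tendsto_const_nhds.congr' ?_
    obtain ⟨N, hN⟩ := exists_nat_ge (X z)
    filter_upwards [eventually_ge_atTop N] with M hM
    rw [min_eq_left (hN.trans (Nat.cast_le.2 hM))]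

/-- **Pollaczek-Khinchine formula**: the expected workload found by the `n`-th arrival at a stable
queue that starts empty converges. -/
theorem tendsto_lindleyMoment_one (hr : 0 < r) [IsProbabilityMeasure ν] (hX : Measurable X)
    (hX0 : ∀ᵐ z ∂ν, 0 ≤ X z) {x₁ x₂ : ℝ} (hx₁ : 0 ≤ x₁) (hx₂ : 0 ≤ x₂)
    (h₁ : ∫⁻ z, ENNReal.ofReal (X z) ∂ν = ENNReal.ofReal x₁)
    (h₂ : ∫⁻ z, ENNReal.ofReal (X z ^ 2) ∂ν = ENNReal.ofReal x₂) (hρ : r * x₁ < 1) :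
    Tendsto (lindleyMoment r ν X 1) atTop (𝓝 (ENNReal.ofReal (r * x₂ / (2 * (1 - r * x₁))))) := by
  have hfin := lindleyMoment_two_one_ne_top hr hX hX0 h₁ h₂
  suffices h : Tendsto (fun n => (lindleyMoment r ν X 1 n).toReal) atTop
      (𝓝 (r * x₂ / (2 * (1 - r * x₁)))) by
    refine ((ENNReal.continuous_ofReal.tendsto _).comp h).congr fun n => ?_
    exact ENNReal.ofReal_toReal (hfin n).2
  -- The third moment of `X` may be infinite. Truncating the input at `M` makes all moments finite
  -- and can only decrease the workload.
  let y (k M : ℕ) : ℝ := (∫⁻ z, ENNReal.ofReal (min (X z) M ^ k) ∂ν).toReal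
  have hXM (M : ℕ) : Measurable fun z => min (X z) (M : ℝ) := by fun_prop
  have hXM0 (M : ℕ) : ∀ᵐ z ∂ν, 0 ≤ min (X z) (M : ℝ) :=
    hX0.mono fun z hz => le_min hz (Nat.cast_nonneg _)
  have hyfin (k M : ℕ) : ∫⁻ z, ENNReal.ofReal (min (X z) M ^ k) ∂ν ≠ ∞ := by
    refine ne_top_of_le_ne_top (b := ∫⁻ _, ENNReal.ofReal ((M : ℝ) ^ k) ∂ν) (by simp) ?_
    refine lintegral_mono_ae ((hXM0 M).mono fun z hz => ?_)
    exact ENNReal.ofReal_le_ofReal (pow_le_pow_left₀ hz (min_le_right _ _) _)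
  have hy (k M : ℕ) : ∫⁻ z, ENNReal.ofReal (min (X z) M ^ k) ∂ν = ENNReal.ofReal (y k M) :=
    (ENNReal.ofReal_toReal (hyfin k M)).symm
  have hy1 (M : ℕ) : ∫⁻ z, ENNReal.ofReal (min (X z) M) ∂ν = ENNReal.ofReal (y 1 M) := by
    simpa using hy 1 M
  have hy1le (M : ℕ) : y 1 M ≤ x₁ := by
    rw [← ENNReal.ofReal_le_ofReal_iff hx₁, ← hy1, ← h₁]
    exact lintegral_mono fun z => ENNReal.ofReal_le_ofReal (min_le_left _ _)
  have hyρ (M : ℕ) : r * y 1 M < 1 :=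
    (mul_le_mul_of_nonneg_left (hy1le M) hr.le).trans_lt hρ
  have hlim (k : ℕ) {x : ℝ} (hx : 0 ≤ x)
      (h : ∫⁻ z, ENNReal.ofReal (X z ^ k) ∂ν = ENNReal.ofReal x) :
      Tendsto (y k) atTop (𝓝 x) := by
    have h1 := tendsto_lintegral_min_pow hX hX0 k
    rw [h] at h1
    have := (ENNReal.tendsto_toReal ENNReal.ofReal_ne_top).comp h1
    rwa [ENNReal.toReal_ofReal hx] at this
  have hPK : Tendsto (fun M => r * y 2 M / (2 * (1 - r * y 1 M))) atTop
      (𝓝 (r * x₂ / (2 * (1 - r * x₁)))) :=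
    ((hlim 2 hx₂ h₂).const_mul r).div
      ((((hlim 1 hx₁ (by simpa using h₁)).const_mul r).const_sub 1).const_mul 2) (by linarith)
  -- The upper bound holds for every `n` by `le_of_second_moment_recursion`. The lower bound comes
  -- from a truncated queue whose limit already exceeds `b`.
  refine tendsto_order.2 ⟨fun b hb => ?_, fun b hb => Eventually.of_forall fun n =>
    (toReal_lindleyMoment_one_le hr hX hX0 hx₁ hx₂ h₁ h₂ hρ n).trans_lt hb⟩
  obtain ⟨M, hM⟩ := ((tendsto_order.1 hPK).1 b hb).exists
  have := tendsto_toReal_lindleyMoment_one_of_third_moment hr (hXM M) (hXM0 M)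
    ENNReal.toReal_nonneg ENNReal.toReal_nonneg ENNReal.toReal_nonneg (hy1 M) (hy 2 M) (hy 3 M)
    (hyρ M)
  filter_upwards [(tendsto_order.1 this).1 b hM] with n hn
  refine hn.trans_le (ENNReal.toReal_mono (hfin n).2 ?_)
  simp only [lindleyMoment, pow_one]
  exact lintegral_lindleyLaw_le_of_le hr (hXM M) hX (fun z => min_le_left _ _)
    (fun v w hvw => ENNReal.ofReal_le_ofReal hvw) n

end Lindley

/-- The probability that an exponential time of rate `r` is less than `u`. -/
def expProb (r u : ℝ) : ℝ :=
  (∫⁻ a, (Set.Iio u).indicator (fun _ => (1 : ℝ≥0∞)) a ∂expMeasure r).toReal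

theorem lintegral_indicator_one_expMeasure {r : ℝ} (hr : 0 < r) (u : ℝ) :
    ∫⁻ a, (Set.Iio u).indicator (fun _ => (1 : ℝ≥0∞)) a ∂expMeasure r =
      ENNReal.ofReal (expProb r u) := by
  have := isProbabilityMeasure_expMeasure hr
  rw [expProb, ENNReal.ofReal_toReal]
  rw [lintegral_indicator measurableSet_Iio]
  simp

theorem expProb_nonneg (r u : ℝ) : 0 ≤ expProb r u := ENNReal.toReal_nonneg

/-- The case `k = 0` of `pow_eq_lintegral_expMeasure`. All later integrals are kept in terms of
`expProb`, which cancels in the end and is never evaluated. -/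
theorem lintegral_indicator_sub_expMeasure {r : ℝ} (hr : 0 < r) {u : ℝ} (hu : 0 ≤ u) :
    ∫⁻ a, (Set.Iio u).indicator (fun a => ENNReal.ofReal (u - a)) a ∂expMeasure r =
      ENNReal.ofReal (u - expProb r u / r) := by
  have h := pow_eq_lintegral_expMeasure hr hu 0
  have hp := expProb_nonneg r u
  simp only [zero_add, pow_one, pow_zero, ENNReal.ofReal_one, Nat.cast_zero,
    lintegral_indicator_one_expMeasure hr] at h
  rw [← ENNReal.ofReal_mul (by positivity)] at h
  rw [show u - expProb r u / r = u - 1 / r * expProb r u by ring,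
    ENNReal.ofReal_sub _ (by positivity), h, ENNReal.add_sub_cancel_right ENNReal.ofReal_ne_top]

theorem expProb_div_le {r : ℝ} (hr : 0 < r) {u : ℝ} (hu : 0 ≤ u) : expProb r u / r ≤ u := by
  have h := pow_eq_lintegral_expMeasure hr hu 0
  have hp := expProb_nonneg r u
  simp only [zero_add, pow_one, pow_zero, ENNReal.ofReal_one, Nat.cast_zero,
    lintegral_indicator_one_expMeasure hr] at h
  rw [← ENNReal.ofReal_mul (by positivity)] at h
  have := (ENNReal.ofReal_le_ofReal_iff hu).1 (le_of_le_of_eq le_add_self h.symm)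
  linarith [show 1 / r * expProb r u = expProb r u / r by ring]

theorem lintegral_indicator_sub_sq_expMeasure {r : ℝ} (hr : 0 < r) {u : ℝ} (hu : 0 ≤ u) :
    ∫⁻ a, (Set.Iio u).indicator (fun a => ENNReal.ofReal ((u - a) ^ 2)) a ∂expMeasure r =
      ENNReal.ofReal (u ^ 2 - 2 / r * (u - expProb r u / r)) := by
  have h := pow_eq_lintegral_expMeasure hr hu 1
  have hp := expProb_div_le hr hu
  simp only [pow_one, Nat.cast_one, lintegral_indicator_sub_expMeasure hr hu] at h
  norm_num only at h
  rw [← ENNReal.ofReal_mul (by positivity)] at h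
  rw [ENNReal.ofReal_sub _ (mul_nonneg (by positivity) (by linarith)), h,
    ENNReal.add_sub_cancel_right ENNReal.ofReal_ne_top]

/-- The expected waiting time until the next arrival when the work ahead is `w`. -/
theorem lintegral_min_expMeasure {r : ℝ} (hr : 0 < r) {w : ℝ} (hw : 0 ≤ w) :
    ∫⁻ a, ENNReal.ofReal (min a w) ∂expMeasure r = ENNReal.ofReal (expProb r w / r) := by
  have := isProbabilityMeasure_expMeasure hr
  have hp := expProb_div_le hr hw
  have hp0 := expProb_nonneg r w
  have hsum : ∫⁻ a, ENNReal.ofReal (min a w) ∂expMeasure r +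
      ∫⁻ a, (Set.Iio w).indicator (fun a => ENNReal.ofReal (w - a)) a ∂expMeasure r =
        ENNReal.ofReal w := by
    rw [← lintegral_add_left (by fun_prop)]
    trans ∫⁻ _, ENNReal.ofReal w ∂expMeasure r
    · refine lintegral_congr_ae ((ae_nonneg_expMeasure r).mono fun a ha => ?_)
      simp only
      by_cases h : a < w
      · rw [Set.indicator_of_mem (Set.mem_Iio.2 h), min_eq_left h.le,
          ← ENNReal.ofReal_add ha (by linarith)]
        congr 1; ring
      · rw [Set.indicator_of_notMem (by simpa using h), min_eq_right (not_lt.1 h), add_zero]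
    · simp
  rw [lintegral_indicator_sub_expMeasure hr hw] at hsum
  rw [← ENNReal.add_left_inj (a := ENNReal.ofReal (w - expProb r w / r)) ENNReal.ofReal_ne_top,
    hsum, ← ENNReal.ofReal_add (by positivity) (by linarith)]
  congr 1; ring

/-! ### The Poisson equation for the wait of a customer that can be overtaken -/

section Preempt

variable {Z : Type*} [MeasurableSpace Z] {r : ℝ} {ν : Measure Z} {X : Z → ℝ}

/-- The transition operator of the pair (work ahead, remaining requirement) of a customer, from
one arrival to the next, killed when the customer leaves. Arrivals are Poisson of rate `r`, and
bring an amount of work with priority over the customer that is distributed like `X`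
under `ν`. -/
def preemptOp (r : ℝ) (ν : Measure Z) (X : Z → ℝ) (f : ℝ × ℝ → ℝ≥0∞) (p : ℝ × ℝ) : ℝ≥0∞ :=
  ∫⁻ a, (Set.Iio (p.1 + p.2)).indicator (fun a => ∫⁻ z, f (max 0 (p.1 - a) + X z,
    p.2 - min p.2 (max 0 (a - p.1))) ∂ν) a ∂expMeasure r

theorem measurable_preemptOp (hr : 0 < r) [IsProbabilityMeasure ν] (hX : Measurable X)
    {f : ℝ × ℝ → ℝ≥0∞} (hf : Measurable f) : Measurable (preemptOp r ν X f) := by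
  have := isProbabilityMeasure_expMeasure hr
  refine Measurable.lintegral_prod_right' (f := fun q : (ℝ × ℝ) × ℝ =>
    (Set.Iio (q.1.1 + q.1.2)).indicator (fun a => ∫⁻ z, f (max 0 (q.1.1 - a) + X z,
    q.1.2 - min q.1.2 (max 0 (a - q.1.1))) ∂ν) q.2) ?_
  have : (fun q : (ℝ × ℝ) × ℝ =>
    (Set.Iio (q.1.1 + q.1.2)).indicator (fun a => ∫⁻ z, f (max 0 (q.1.1 - a) + X z,
    q.1.2 - min q.1.2 (max 0 (a - q.1.1))) ∂ν) q.2) =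
    {q : (ℝ × ℝ) × ℝ | q.2 < q.1.1 + q.1.2}.indicator fun q =>
      ∫⁻ z, f (max 0 (q.1.1 - q.2) + X z, q.1.2 - min q.1.2 (max 0 (q.2 - q.1.1))) ∂ν := by
    ext q
    simp only [Set.indicator_apply, Set.mem_Iio, Set.mem_ofPred_eq]
  rw [this]
  refine Measurable.indicator ?_ (measurableSet_lt (by fun_prop) (by fun_prop))
  exact Measurable.lintegral_prod_right' (f := fun q : ((ℝ × ℝ) × ℝ) × Z =>
    f (max 0 (q.1.1.1 - q.1.2) + X q.2, q.1.1.2 - min q.1.1.2 (max 0 (q.1.2 - q.1.1.1))))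
    (by fun_prop)

theorem preemptOp_mono (hX0 : ∀ᵐ z ∂ν, 0 ≤ X z) {f g : ℝ × ℝ → ℝ≥0∞}
    (hfg : ∀ p, 0 ≤ p.1 → 0 ≤ p.2 → f p ≤ g p) (p : ℝ × ℝ) :
    preemptOp r ν X f p ≤ preemptOp r ν X g p := by
  refine lintegral_mono fun a => Set.indicator_le_indicator ?_
  refine lintegral_mono_ae (hX0.mono fun z hz => hfg _ ?_ ?_)
  · exact add_nonneg (le_max_left _ _) hz
  · exact sub_nonneg.2 (min_le_left _ _)

theorem measurable_preemptOp_inner [IsProbabilityMeasure ν] (hX : Measurable X)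
    {f : ℝ × ℝ → ℝ≥0∞} (hf : Measurable f) (p : ℝ × ℝ) :
    Measurable ((Set.Iio (p.1 + p.2)).indicator (fun a => ∫⁻ z, f (max 0 (p.1 - a) + X z,
      p.2 - min p.2 (max 0 (a - p.1))) ∂ν)) := by
  refine Measurable.indicator ?_ measurableSet_Iio
  exact Measurable.lintegral_prod_right' (f := fun q : ℝ × Z =>
    f (max 0 (p.1 - q.1) + X q.2, p.2 - min p.2 (max 0 (q.1 - p.1)))) (by fun_prop)

theorem preemptOp_add [IsProbabilityMeasure ν] (hX : Measurable X)
    {f g : ℝ × ℝ → ℝ≥0∞} (hf : Measurable f) :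
    preemptOp r ν X (f + g) = preemptOp r ν X f + preemptOp r ν X g := by
  ext p
  rw [Pi.add_apply, preemptOp, preemptOp, preemptOp,
    ← lintegral_add_left (measurable_preemptOp_inner hX hf p)]
  refine lintegral_congr fun a => ?_
  simp only [Set.indicator_apply]
  split_ifs
  · exact lintegral_add_left (by fun_prop) _
  · rw [add_zero]

theorem preemptOp_const_mul [IsProbabilityMeasure ν] (hX : Measurable X)
    {f : ℝ × ℝ → ℝ≥0∞} (hf : Measurable f) (c : ℝ≥0∞) :
    preemptOp r ν X (fun p => c * f p) = fun p => c * preemptOp r ν X f p := by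
  ext p
  rw [preemptOp, preemptOp, ← lintegral_const_mul _ (measurable_preemptOp_inner hX hf p)]
  refine lintegral_congr fun a => ?_
  rw [← Set.indicator_const_mul]
  congr 1
  ext a
  rw [lintegral_const_mul _ (by fun_prop)]

theorem measurable_iterate_preemptOp (hr : 0 < r) [IsProbabilityMeasure ν] (hX : Measurable X)
    {f : ℝ × ℝ → ℝ≥0∞} (hf : Measurable f) (k : ℕ) : Measurable ((preemptOp r ν X)^[k] f) := by
  induction k with
  | zero => exact hf
  | succ k ih =>
    rw [Function.iterate_succ_apply']
    exact measurable_preemptOp hr hX ih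

theorem iterate_preemptOp_mono (hX0 : ∀ᵐ z ∂ν, 0 ≤ X z) {f g : ℝ × ℝ → ℝ≥0∞}
    (hfg : ∀ p, 0 ≤ p.1 → 0 ≤ p.2 → f p ≤ g p) (k : ℕ) (p : ℝ × ℝ) (h1 : 0 ≤ p.1) (h2 : 0 ≤ p.2) :
    (preemptOp r ν X)^[k] f p ≤ (preemptOp r ν X)^[k] g p := by
  induction k generalizing p with
  | zero => exact hfg p h1 h2
  | succ k ih =>
    rw [Function.iterate_succ_apply', Function.iterate_succ_apply']
    exact preemptOp_mono hX0 ih p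

theorem iterate_preemptOp_congr (hX0 : ∀ᵐ z ∂ν, 0 ≤ X z) {f g : ℝ × ℝ → ℝ≥0∞}
    (hfg : ∀ p, 0 ≤ p.1 → 0 ≤ p.2 → f p = g p) (k : ℕ) (p : ℝ × ℝ) (h1 : 0 ≤ p.1) (h2 : 0 ≤ p.2) :
    (preemptOp r ν X)^[k] f p = (preemptOp r ν X)^[k] g p :=
  le_antisymm (iterate_preemptOp_mono hX0 (fun p h h' => (hfg p h h').le) k p h1 h2)
    (iterate_preemptOp_mono hX0 (fun p h h' => (hfg p h h').ge) k p h1 h2)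

theorem iterate_preemptOp_add (hr : 0 < r) [IsProbabilityMeasure ν] (hX : Measurable X)
    {f g : ℝ × ℝ → ℝ≥0∞} (hf : Measurable f) (k : ℕ) :
    (preemptOp r ν X)^[k] (f + g) = (preemptOp r ν X)^[k] f + (preemptOp r ν X)^[k] g := by
  induction k with
  | zero => rfl
  | succ k ih =>
    rw [Function.iterate_succ_apply', Function.iterate_succ_apply', Function.iterate_succ_apply',
      ih, preemptOp_add hX (measurable_iterate_preemptOp hr hX hf k)]

theorem iterate_preemptOp_const_mul (hr : 0 < r) [IsProbabilityMeasure ν] (hX : Measurable X)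
    {f : ℝ × ℝ → ℝ≥0∞} (hf : Measurable f) (c : ℝ≥0∞) (k : ℕ) :
    (preemptOp r ν X)^[k] (fun p => c * f p) = fun p => c * (preemptOp r ν X)^[k] f p := by
  induction k with
  | zero => rfl
  | succ k ih =>
    rw [Function.iterate_succ_apply', Function.iterate_succ_apply', ih,
      preemptOp_const_mul hX (measurable_iterate_preemptOp hr hX hf k)]

/-- Unrolling a Poisson equation. -/
theorem sum_iterate_preemptOp (hr : 0 < r) [IsProbabilityMeasure ν] (hX : Measurable X)
    (hX0 : ∀ᵐ z ∂ν, 0 ≤ X z) {h c : ℝ × ℝ → ℝ≥0∞} (hc : Measurable c)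
    (hh : ∀ p, 0 ≤ p.1 → 0 ≤ p.2 → c p + preemptOp r ν X h p = h p) (N : ℕ) (p : ℝ × ℝ)
    (h1 : 0 ≤ p.1) (h2 : 0 ≤ p.2) :
    ∑ k ∈ Finset.range N, (preemptOp r ν X)^[k] c p + (preemptOp r ν X)^[N] h p = h p := by
  induction N with
  | zero => simp
  | succ N ih =>
    rw [Finset.sum_range_succ, add_assoc, Function.iterate_succ_apply, ← Pi.add_apply,
      ← iterate_preemptOp_add hr hX hc,
      iterate_preemptOp_congr (f := c + preemptOp r ν X h) hX0 hh N p h1 h2, ih]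

/-- The work before the departure of the customer decreases at unit rate between arrivals. -/
theorem preemptOp_comp_add {F : ℝ → ℝ≥0∞} (p : ℝ × ℝ) (h2 : 0 ≤ p.2) :
    preemptOp r ν X (fun p => F (p.1 + p.2)) p = ∫⁻ a, (Set.Iio (p.1 + p.2)).indicator
      (fun a => ∫⁻ z, F (p.1 + p.2 - a + X z) ∂ν) a ∂expMeasure r := by
  refine lintegral_congr fun a => ?_
  by_cases ha : a < p.1 + p.2
  · rw [Set.indicator_of_mem (Set.mem_Iio.2 ha), Set.indicator_of_mem (Set.mem_Iio.2 ha)]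
    refine lintegral_congr fun z => congrArg F ?_
    simp only
    rcases le_total a p.1 with h | h
    · rw [max_eq_right (sub_nonneg.2 h), max_eq_left (sub_nonpos.2 h), min_eq_right h2]
      ring
    · rw [max_eq_left (sub_nonpos.2 h), max_eq_right (sub_nonneg.2 h), min_eq_right (by linarith)]
      ring
  · rw [Set.indicator_of_notMem (by simpa using ha), Set.indicator_of_notMem (by simpa using ha)]

/-- A quadratic in the work until departure serves as a Lyapunov function: with the right `B`, its
expected decrease per step is a multiple of that work. -/
theorem preemptOp_quadratic (hr : 0 < r) [IsProbabilityMeasure ν] (hX : Measurable X)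
    (hX0 : ∀ᵐ z ∂ν, 0 ≤ X z) {x₁ x₂ : ℝ} (hx₁ : 0 ≤ x₁) (hx₂ : 0 ≤ x₂)
    (h₁ : ∫⁻ z, ENNReal.ofReal (X z) ∂ν = ENNReal.ofReal x₁)
    (h₂ : ∫⁻ z, ENNReal.ofReal (X z ^ 2) ∂ν = ENNReal.ofReal x₂) {B : ℝ} (hB : 0 ≤ B)
    (p : ℝ × ℝ) (hp1 : 0 ≤ p.1) (hp2 : 0 ≤ p.2) :
    preemptOp r ν X (fun p => ENNReal.ofReal ((p.1 + p.2) ^ 2 + B * (p.1 + p.2))) p =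
      ENNReal.ofReal ((p.1 + p.2) ^ 2 - 2 / r * (p.1 + p.2 - expProb r (p.1 + p.2) / r) +
        (2 * x₁ + B) * (p.1 + p.2 - expProb r (p.1 + p.2) / r) +
        (x₂ + B * x₁) * expProb r (p.1 + p.2)) := by
  rw [preemptOp_comp_add (F := fun u => ENNReal.ofReal (u ^ 2 + B * u)) p hp2]
  set u := p.1 + p.2 with hu
  have hu0 : 0 ≤ u := add_nonneg hp1 hp2
  have hpu := expProb_div_le hr hu0
  have hp0 := expProb_nonneg r u
  have hin : ∀ a, (Set.Iio u).indicator
      (fun a => ∫⁻ z, ENNReal.ofReal ((u - a + X z) ^ 2 + B * (u - a + X z)) ∂ν) a =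
      (Set.Iio u).indicator (fun a => ENNReal.ofReal ((u - a) ^ 2)) a +
      ENNReal.ofReal (2 * x₁ + B) * (Set.Iio u).indicator (fun a => ENNReal.ofReal (u - a)) a +
      ENNReal.ofReal (x₂ + B * x₁) * (Set.Iio u).indicator (fun _ => 1) a := by
    intro a
    by_cases ha : a < u
    · have ha' : 0 ≤ u - a := by linarith
      simp only [Set.indicator_of_mem (Set.mem_Iio.2 ha)]
      have : ∀ᵐ z ∂ν, ENNReal.ofReal ((u - a + X z) ^ 2 + B * (u - a + X z)) =
          ENNReal.ofReal ((u - a) ^ 2 + B * (u - a)) +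
          (ENNReal.ofReal (2 * (u - a) + B) * ENNReal.ofReal (X z) +
            ENNReal.ofReal (X z ^ 2)) := by
        refine hX0.mono fun z hz => ?_
        rw [← ENNReal.ofReal_mul (by positivity), ← ENNReal.ofReal_add (by positivity)
          (by positivity), ← ENNReal.ofReal_add (by positivity) (by positivity)]
        congr 1; ring
      rw [lintegral_congr_ae this, lintegral_add_left (by fun_prop),
        lintegral_add_left (by fun_prop), lintegral_const_mul _ (by fun_prop), h₁, h₂,
        lintegral_const, measure_univ, mul_one, mul_one, ← ENNReal.ofReal_mul (by positivity),
        ← ENNReal.ofReal_mul (by positivity), ← ENNReal.ofReal_add (by positivity) (by positivity),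
        ← ENNReal.ofReal_add (by positivity) (by positivity),
        ← ENNReal.ofReal_add (by positivity) (by positivity),
        ← ENNReal.ofReal_add (by positivity) (by positivity)]
      congr 1; ring
    · simp [ha]
  have hm (F : ℝ → ℝ≥0∞) (hF : Measurable F) : Measurable ((Set.Iio u).indicator F) :=
    hF.indicator measurableSet_Iio
  have hsq : 0 ≤ u ^ 2 - 2 / r * (u - expProb r u / r) := by
    have h := pow_eq_lintegral_expMeasure hr hu0 1
    simp only [pow_one, Nat.cast_one, lintegral_indicator_sub_expMeasure hr hu0] at h
    norm_num only at h
    rw [← ENNReal.ofReal_mul (by positivity)] at h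
    exact sub_nonneg.2 ((ENNReal.ofReal_le_ofReal_iff (by positivity)).1
      (le_of_le_of_eq le_add_self h.symm))
  have hlin : 0 ≤ u - expProb r u / r := by linarith
  simp only [hin]
  rw [lintegral_add_right _ ((hm _ (by fun_prop)).const_mul _),
    lintegral_add_right _ ((hm _ (by fun_prop)).const_mul _),
    lintegral_const_mul _ (hm _ (by fun_prop)), lintegral_const_mul _ (hm _ (by fun_prop)),
    lintegral_indicator_sub_sq_expMeasure hr hu0, lintegral_indicator_sub_expMeasure hr hu0,
    lintegral_indicator_one_expMeasure hr, ← ENNReal.ofReal_mul (by positivity),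
    ← ENNReal.ofReal_mul (by positivity), ← ENNReal.ofReal_add hsq (by positivity),
    ← ENNReal.ofReal_add (by positivity) (by positivity)]

/-- The expected remaining waiting time solves the Poisson equation. -/
theorem preemptOp_linear (hr : 0 < r) [IsProbabilityMeasure ν] (hX : Measurable X)
    (hX0 : ∀ᵐ z ∂ν, 0 ≤ X z) {x₁ : ℝ} (hx₁ : 0 ≤ x₁)
    (h₁ : ∫⁻ z, ENNReal.ofReal (X z) ∂ν = ENNReal.ofReal x₁) (hρ : r * x₁ < 1)
    (p : ℝ × ℝ) (hp1 : 0 ≤ p.1) (hp2 : 0 ≤ p.2) :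
    ∫⁻ a, ENNReal.ofReal (min a p.1) ∂expMeasure r +
      preemptOp r ν X (fun p => ENNReal.ofReal ((p.1 + r * x₁ * p.2) / (1 - r * x₁))) p =
      ENNReal.ofReal ((p.1 + r * x₁ * p.2) / (1 - r * x₁)) := by
  obtain ⟨w, s⟩ := p
  simp only at hp1 hp2
  have hu0 : 0 ≤ w + s := add_nonneg hp1 hp2
  have hpu := expProb_div_le hr hu0
  have hp0 := expProb_nonneg r (w + s)
  have hpw := expProb_div_le hr hp1
  have hpw0 := expProb_nonneg r w
  have hd : 0 < 1 - r * x₁ := by linarith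
  have hα : 0 < (1 - r * x₁)⁻¹ := by positivity
  set α := (1 - r * x₁)⁻¹ with hαdef
  have hβ : 0 ≤ r * x₁ * α := by positivity
  -- With this identity `(w' + r x₁ s')/(1 - r x₁) = w' + r x₁ α (w' + s')`. The candidate thus
  -- splits into the work ahead and the total work, whose expectations after an exponential time are
  -- known.
  have hαβ : α = 1 + r * x₁ * α := by rw [hαdef]; field_simp; ring
  have hin : ∀ a, (Set.Iio (w + s)).indicator (fun a => ∫⁻ z, ENNReal.ofReal
      ((max 0 (w - a) + X z + r * x₁ * (s - min s (max 0 (a - w)))) / (1 - r * x₁)) ∂ν) a =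
      (Set.Iio w).indicator (fun a => ENNReal.ofReal (w - a)) a +
      ENNReal.ofReal (r * x₁ * α) *
        (Set.Iio (w + s)).indicator (fun a => ENNReal.ofReal (w + s - a)) a +
      ENNReal.ofReal (α * x₁) * (Set.Iio (w + s)).indicator (fun _ => 1) a := by
    intro a
    by_cases ha : a < w + s
    · have ha' : 0 ≤ w + s - a := by linarith
      simp only [Set.indicator_of_mem (Set.mem_Iio.2 ha)]
      have hw' : (Set.Iio w).indicator (fun a => ENNReal.ofReal (w - a)) a =
          ENNReal.ofReal (max 0 (w - a)) := by
        by_cases h : a < w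
        · rw [Set.indicator_of_mem (Set.mem_Iio.2 h), max_eq_right (by linarith)]
        · rw [Set.indicator_of_notMem (by simpa using h), max_eq_left (by linarith)]
          simp
      have hs' : s - min s (max 0 (a - w)) = w + s - a - max 0 (w - a) := by
        rcases le_total a w with h | h
        · rw [max_eq_right (sub_nonneg.2 h), max_eq_left (sub_nonpos.2 h), min_eq_right hp2]
          ring
        · rw [max_eq_left (sub_nonpos.2 h), max_eq_right (sub_nonneg.2 h),
            min_eq_right (by linarith)]
          ring
      have hmax : 0 ≤ max 0 (w - a) := le_max_left _ _
      rw [hw', hs']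
      set y := max 0 (w - a)
      have : ∀ᵐ z ∂ν, ENNReal.ofReal ((y + X z + r * x₁ * (w + s - a - y)) / (1 - r * x₁)) =
          ENNReal.ofReal (y + r * x₁ * α * (w + s - a)) +
          ENNReal.ofReal α * ENNReal.ofReal (X z) := by
        refine hX0.mono fun z hz => ?_
        rw [← ENNReal.ofReal_mul (by positivity), ← ENNReal.ofReal_add (by positivity)
          (by positivity)]
        congr 1
        rw [div_eq_mul_inv, ← hαdef]
        linear_combination (y * hαβ)
      rw [lintegral_congr_ae this, lintegral_add_left (by fun_prop),
        lintegral_const_mul _ (by fun_prop), h₁,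
        lintegral_const, measure_univ, mul_one, mul_one, ← ENNReal.ofReal_mul (by positivity),
        ← ENNReal.ofReal_mul (by positivity), ← ENNReal.ofReal_add (by positivity) (by positivity),
        ← ENNReal.ofReal_add (by positivity) (by positivity),
        ← ENNReal.ofReal_add (by positivity) (by positivity)]
    · have : ¬ a < w := fun h => ha (by linarith)
      simp [ha, this]
  have hm (u : ℝ) (F : ℝ → ℝ≥0∞) (hF : Measurable F) : Measurable ((Set.Iio u).indicator F) :=
    hF.indicator measurableSet_Iio
  have hlin : 0 ≤ w + s - expProb r (w + s) / r := by linarith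
  have hlin' : 0 ≤ w - expProb r w / r := by linarith
  rw [preemptOp]
  simp only [hin]
  rw [lintegral_add_right _ ((hm _ _ (by fun_prop)).const_mul _),
    lintegral_add_right _ ((hm _ _ (by fun_prop)).const_mul _),
    lintegral_const_mul _ (hm _ _ (by fun_prop)), lintegral_const_mul _ (hm _ _ (by fun_prop)),
    lintegral_indicator_sub_expMeasure hr hp1, lintegral_indicator_sub_expMeasure hr hu0,
    lintegral_indicator_one_expMeasure hr, lintegral_min_expMeasure hr hp1,
    ← ENNReal.ofReal_mul (by positivity),
    ← ENNReal.ofReal_mul (by positivity), ← ENNReal.ofReal_add hlin' (by positivity),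
    ← ENNReal.ofReal_add (by positivity) (by positivity),
    ← ENNReal.ofReal_add (by positivity) (by positivity)]
  congr 1
  have h3 : r * x₁ * α * (expProb r (w + s) / r) = α * x₁ * expProb r (w + s) := by
    field_simp
  rw [show (w + r * x₁ * s) / (1 - r * x₁) = (w + r * x₁ * s) * α from div_eq_mul_inv _ _]
  linear_combination (-h3 - w * hαβ)

/-- The total expected waiting time of a customer with work `p.1` ahead and requirement `p.2`. -/
theorem tsum_iterate_preemptOp (hr : 0 < r) [IsProbabilityMeasure ν] (hX : Measurable X)
    (hX0 : ∀ᵐ z ∂ν, 0 ≤ X z) {x₁ x₂ : ℝ} (hx₁ : 0 ≤ x₁) (hx₂ : 0 ≤ x₂)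
    (h₁ : ∫⁻ z, ENNReal.ofReal (X z) ∂ν = ENNReal.ofReal x₁)
    (h₂ : ∫⁻ z, ENNReal.ofReal (X z ^ 2) ∂ν = ENNReal.ofReal x₂) (hρ : r * x₁ < 1)
    (p : ℝ × ℝ) (hp1 : 0 ≤ p.1) (hp2 : 0 ≤ p.2) :
    ∑' k, (preemptOp r ν X)^[k] (fun p => ∫⁻ a, ENNReal.ofReal (min a p.1) ∂expMeasure r) p =
      ENNReal.ofReal ((p.1 + r * x₁ * p.2) / (1 - r * x₁)) := by
  have := isProbabilityMeasure_expMeasure hr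
  have hd : 0 < 1 - r * x₁ := by linarith
  set h : ℝ × ℝ → ℝ≥0∞ := fun p => ENNReal.ofReal ((p.1 + r * x₁ * p.2) / (1 - r * x₁)) with hh
  set U : ℝ × ℝ → ℝ≥0∞ := fun p => ENNReal.ofReal (p.1 + p.2) with hU
  -- `B` is chosen so that all terms with `expProb` cancel and `g` decreases by exactly `δ * U` in
  -- expectation per step.
  set δ := 2 / r * (1 - r * x₁) with hδ
  have hδ0 : 0 < δ := by positivity
  set B := (δ + r * x₂) / (1 - r * x₁) with hB
  have hB0 : 0 ≤ B := by positivity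
  set g : ℝ × ℝ → ℝ≥0∞ := fun p => ENNReal.ofReal ((p.1 + p.2) ^ 2 + B * (p.1 + p.2)) with hg
  have hgU : ∀ p : ℝ × ℝ, 0 ≤ p.1 → 0 ≤ p.2 →
      ENNReal.ofReal δ * U p + preemptOp r ν X g p = g p := by
    intro p hp1 hp2
    have hu0 : 0 ≤ p.1 + p.2 := add_nonneg hp1 hp2
    rw [hg, preemptOp_quadratic hr hX hX0 hx₁ hx₂ h₁ h₂ hB0 p hp1 hp2, hU]
    simp only
    set u := p.1 + p.2
    have hBd : B * (1 - r * x₁) = δ + r * x₂ := div_mul_cancel₀ _ hd.ne'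
    have heq : u ^ 2 - 2 / r * (u - expProb r u / r) + (2 * x₁ + B) * (u - expProb r u / r) +
        (x₂ + B * x₁) * expProb r u = u ^ 2 + B * u - δ * u := by
      have : (2 / r * (expProb r u / r)) - (2 * x₁ + B) * (expProb r u / r) +
          (x₂ + B * x₁) * expProb r u =
          expProb r u / r * (2 / r * (1 - r * x₁) + r * x₂ - B * (1 - r * x₁)) := by
        field_simp
        ring
      rw [hBd, hδ] at this
      have hr2 : 2 / r * (r * x₁) = 2 * x₁ := by field_simp
      rw [hδ]
      linear_combination this - u * hr2
    have hnn : 0 ≤ u ^ 2 + B * u - δ * u := by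
      have : δ ≤ B := by
        rw [hB, le_div_iff₀ hd]
        have h1 : 0 ≤ r * x₂ := by positivity
        have h2 : 0 ≤ δ * (r * x₁) := by positivity
        linarith
      nlinarith [mul_le_mul_of_nonneg_right this hu0]
    rw [heq, ← ENNReal.ofReal_mul hδ0.le, ← ENNReal.ofReal_add (by positivity) hnn]
    congr 1; ring
  have hUm : Measurable U := by fun_prop
  -- Telescoping bounds `δ` times the sum of the iterates of `U` by `g p < ∞`, so the iterates tend
  -- to `0`. This is the only use of the second moment here.
  have hUsum : Tendsto (fun k => (preemptOp r ν X)^[k] U p) atTop (𝓝 0) := by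
    refine ENNReal.tendsto_atTop_zero_of_tsum_ne_top fun htop => ?_
    have hle : ENNReal.ofReal δ * ∑' k, (preemptOp r ν X)^[k] U p ≤ g p := by
      rw [← ENNReal.tsum_mul_left, ENNReal.tsum_eq_iSup_nat]
      refine iSup_le fun N => ?_
      have := sum_iterate_preemptOp hr hX hX0 (hUm.const_mul _) hgU N p hp1 hp2
      rw [← this]
      refine le_add_right (le_of_eq (Finset.sum_congr rfl fun k _ => ?_))
      rw [iterate_preemptOp_const_mul hr hX hUm]
    rw [htop, ENNReal.mul_top (ENNReal.ofReal_pos.2 hδ0).ne', top_le_iff] at hle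
    exact ENNReal.ofReal_ne_top hle
  -- Since `h ≤ U / (1 - r x₁)`, the remainder in the unrolled Poisson equation vanishes, and the
  -- sum of expected waits is exactly `h p`.
  have hhlim : Tendsto (fun k => (preemptOp r ν X)^[k] h p) atTop (𝓝 0) := by
    have hlim := ENNReal.Tendsto.const_mul (a := ENNReal.ofReal (1 - r * x₁)⁻¹) hUsum
      (Or.inr ENNReal.ofReal_ne_top)
    rw [mul_zero] at hlim
    refine tendsto_of_tendsto_of_tendsto_of_le_of_le tendsto_const_nhds hlim
      (fun _ => bot_le) fun k => ?_
    have := iterate_preemptOp_mono (r := r) hX0 (f := h)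
      (g := fun p => ENNReal.ofReal (1 - r * x₁)⁻¹ * U p) (fun p h1 h2 => ?_) k p hp1 hp2
    · rwa [iterate_preemptOp_const_mul hr hX hUm] at this
    · simp only [hh, hU]
      rw [← ENNReal.ofReal_mul (by positivity), mul_comm (1 - r * x₁)⁻¹, ← div_eq_mul_inv]
      refine ENNReal.ofReal_le_ofReal (div_le_div_of_nonneg_right ?_ hd.le)
      nlinarith
  have hcm : Measurable fun p : ℝ × ℝ => ∫⁻ a, ENNReal.ofReal (min a p.1) ∂expMeasure r :=
    Measurable.lintegral_prod_right' (f := fun q : (ℝ × ℝ) × ℝ =>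
      ENNReal.ofReal (min q.2 q.1.1)) (by fun_prop)
  have hsum := sum_iterate_preemptOp hr hX hX0 hcm (preemptOp_linear hr hX hX0 hx₁ h₁ hρ)
  have hlim := (ENNReal.tendsto_nat_tsum (fun k => (preemptOp r ν X)^[k]
    (fun p => ∫⁻ a, ENNReal.ofReal (min a p.1) ∂expMeasure r) p)).add hhlim
  rw [add_zero] at hlim
  exact tendsto_nhds_unique hlim (tendsto_const_nhds.congr fun N => (hsum N p hp1 hp2).symm)

end Preempt

/-! ### The Markov property of the tagged customer -/

section Tagged

variable {Y : Type*}

/-- The workload found by arrival `m`. -/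
def workloadFound (X : Y → ℝ) (m : ℕ) (ω : ℕ → ℝ × Y) : ℝ :=
  PRQueue.lindley (fun j => (ω j).1) (fun j => X (ω j).2) m

/-- The work ahead and the remaining requirement of customer `n` at the arrival of customer
`n + k`, where an earlier arrival with mark `y` puts the work `X y` ahead of customer `n`, a later
arrival the work `X' y`, and the requirement of customer `n` is `S y`. -/
def taggedState (X X' S : Y → ℝ) (n : ℕ) : ℕ → (ℕ → ℝ × Y) → ℝ × ℝ
  | 0, ω => (workloadFound X n ω, S (ω n).2)
  | k + 1, ω =>
      (max 0 ((taggedState X X' S n k ω).1 - (ω (n + k)).1) + X' (ω (n + k + 1)).2,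
        (taggedState X X' S n k ω).2 - min (taggedState X X' S n k ω).2
          (max 0 ((ω (n + k)).1 - (taggedState X X' S n k ω).1)))

/-- The set of sample paths on which customer `n` is present at the arrival of customer `n + k`. -/
def taggedPresent (X X' S : Y → ℝ) (n k : ℕ) : Set (ℕ → ℝ × Y) :=
  {ω | ∀ j < k, (ω (n + j)).1 < (taggedState X X' S n j ω).1 + (taggedState X X' S n j ω).2}

variable {X X' S : Y → ℝ}

theorem workloadFound_congr {ω ω' : ℕ → ℝ × Y} {m : ℕ} (h : ∀ j < m, ω j = ω' j) :
    workloadFound X m ω = workloadFound X m ω' :=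
  PRQueue.lindley_congr (fun j hj => by rw [h j hj]) (fun j hj => by rw [h j hj])

/-- The state just after arrival `n + k` does not involve the gap that follows it, so that gap is
independent of the state. -/
theorem taggedState_congr {ω ω' : ℕ → ℝ × Y} {n k : ℕ} (h : ∀ j < n + k, ω j = ω' j)
    (h' : (ω (n + k)).2 = (ω' (n + k)).2) :
    taggedState X X' S n k ω = taggedState X X' S n k ω' := by
  induction k with
  | zero =>
    simp only [add_zero] at h h'
    rw [taggedState, taggedState, workloadFound_congr h, h']
  | succ k ih =>
    rw [taggedState, taggedState, ih (fun j hj => h j (by omega)) (by rw [h (n + k) (by omega)]),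
      h (n + k) (by omega), ← add_assoc] at *
    rw [h']

theorem mem_taggedPresent_congr {ω ω' : ℕ → ℝ × Y} {n k : ℕ} (h : ∀ j < n + k, ω j = ω' j) :
    ω ∈ taggedPresent X X' S n k ↔ ω' ∈ taggedPresent X X' S n k := by
  refine forall₂_congr fun j hj => ?_
  rw [taggedState_congr (ω := ω) (ω' := ω') (fun i hi => h i (by omega))
    (by rw [h (n + j) (by omega)]), h (n + j) (by omega)]

theorem mem_taggedPresent_succ {ω : ℕ → ℝ × Y} {n k : ℕ} :
    ω ∈ taggedPresent X X' S n (k + 1) ↔ ω ∈ taggedPresent X X' S n k ∧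
      (ω (n + k)).1 < (taggedState X X' S n k ω).1 + (taggedState X X' S n k ω).2 := by
  constructor
  · exact fun h => ⟨fun j hj => h j (by omega), h k (by omega)⟩
  · rintro ⟨h, h'⟩ j hj
    rcases Nat.lt_succ_iff_lt_or_eq.1 hj with hj | rfl
    · exact h j hj
    · exact h'

variable [MeasurableSpace Y]

theorem measurable_workloadFound (hX : Measurable X) (m : ℕ) : Measurable (workloadFound X m) := by
  induction m with
  | zero => exact measurable_const
  | succ m ih =>
    change Measurable fun ω : ℕ → ℝ × Y => max 0 (workloadFound X m ω + X (ω m).2 - (ω m).1)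
    fun_prop

theorem measurable_taggedState (hX : Measurable X) (hX' : Measurable X') (hS : Measurable S)
    (n k : ℕ) : Measurable (taggedState X X' S n k) := by
  induction k with
  | zero =>
    have := measurable_workloadFound hX n
    change Measurable fun ω : ℕ → ℝ × Y => (workloadFound X n ω, S (ω n).2)
    fun_prop
  | succ k ih =>
    change Measurable fun ω : ℕ → ℝ × Y =>
      (max 0 ((taggedState X X' S n k ω).1 - (ω (n + k)).1) + X' (ω (n + k + 1)).2,
        (taggedState X X' S n k ω).2 - min (taggedState X X' S n k ω).2
          (max 0 ((ω (n + k)).1 - (taggedState X X' S n k ω).1)))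
    fun_prop

theorem measurableSet_taggedPresent (hX : Measurable X) (hX' : Measurable X') (hS : Measurable S)
    (n k : ℕ) : MeasurableSet (taggedPresent X X' S n k) := by
  have h := measurable_taggedState hX hX' hS n
  have : taggedPresent X X' S n k = ⋂ j, ⋂ (_ : j < k), {ω | (ω (n + j)).1 <
      (taggedState X X' S n j ω).1 + (taggedState X X' S n j ω).2} := by
    ext ω; simp [taggedPresent]
  rw [this]
  refine MeasurableSet.iInter fun j => MeasurableSet.iInter fun _ => measurableSet_lt ?_ ?_
  · fun_prop
  · exact (measurable_fst.comp (h j)).add (measurable_snd.comp (h j))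

variable {r : ℝ} {ν : Measure Y}

/-- The law of an i.i.d. sequence of exponential gaps and independent marks. -/
def markedLaw (r : ℝ) (ν : Measure Y) : Measure (ℕ → ℝ × Y) :=
  Measure.infinitePi fun _ : ℕ => (expMeasure r).prod ν

/-- The workload found by arrival `m` depends only on earlier coordinates. Coordinate `m` can be
resampled, and this performs one step of `lindleyLaw`. -/
theorem lintegral_workloadFound (hr : 0 < r) [IsProbabilityMeasure ν] (hX : Measurable X) (m : ℕ)
    {f : ℝ → ℝ≥0∞} (hf : Measurable f) :
    ∫⁻ ω, f (workloadFound X m ω) ∂markedLaw r ν = ∫⁻ v, f v ∂lindleyLaw r ν X m := by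
  have := isProbabilityMeasure_expMeasure hr
  induction m generalizing f with
  | zero =>
    have : IsProbabilityMeasure (markedLaw r ν) := by unfold markedLaw; infer_instance
    simp [workloadFound, PRQueue.lindley, lindleyLaw, lintegral_dirac' _ hf]
  | succ m ih =>
    have hm := measurable_workloadFound hX (m + 1)
    rw [lintegral_lindleyLaw_succ hr hX m hf, ← ih, markedLaw,
      ← lintegral_infinitePi_update _ m
        (F := fun ω => f (workloadFound X (m + 1) ω)) (hf.comp hm)]
    · refine lintegral_congr fun ω => ?_
      rw [lintegral_prod_symm]
      · refine lintegral_congr fun y => lintegral_congr fun a => congrArg f ?_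
        have h : workloadFound X m (Function.update ω m (a, y)) = workloadFound X m ω :=
          workloadFound_congr fun j hj => Function.update_of_ne hj.ne _ _
        rw [← h]
        change max 0 (workloadFound X m (Function.update ω m (a, y)) +
          X (Function.update ω m (a, y) m).2 - (Function.update ω m (a, y) m).1) = _
        rw [Function.update_self]
      · exact ((hf.comp hm).comp (measurable_update ω)).aemeasurable
    · refine Measurable.lintegral_prod_right' (f := fun q : ℝ × Y =>
        ∫⁻ a, f (max 0 (q.1 + X q.2 - a)) ∂expMeasure r) ?_
      exact Measurable.lintegral_prod_right' (f := fun q : (ℝ × Y) × ℝ =>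
        f (max 0 (q.1.1 + X q.1.2 - q.2))) (by fun_prop)

theorem lintegral_update_gap (hr : 0 < r) [IsProbabilityMeasure ν] (m : ℕ)
    {F : (ℕ → ℝ × Y) → ℝ≥0∞} (hF : Measurable F) :
    ∫⁻ ω, ∫⁻ a, F (Function.update ω m (a, (ω m).2)) ∂expMeasure r ∂markedLaw r ν =
      ∫⁻ ω, F ω ∂markedLaw r ν := by
  have := isProbabilityMeasure_expMeasure hr
  refine lintegral_infinitePi_update_map _ (expMeasure r)
    (g := fun q : (ℝ × Y) × ℝ => (q.2, q.1.2)) (by fun_prop) ?_ m hF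
  refine (Measure.prod_eq fun s t hs ht => ?_).symm
  rw [Measure.map_apply (by fun_prop) (hs.prod ht)]
  have : (fun q : (ℝ × Y) × ℝ => (q.2, q.1.2)) ⁻¹' s ×ˢ t = (Set.univ ×ˢ t) ×ˢ s := by
    ext q; simp [and_comm]
  rw [this, Measure.prod_prod, Measure.prod_prod, measure_univ, one_mul, mul_comm]

theorem lintegral_update_mark (hr : 0 < r) [IsProbabilityMeasure ν] (m : ℕ)
    {F : (ℕ → ℝ × Y) → ℝ≥0∞} (hF : Measurable F) :
    ∫⁻ ω, ∫⁻ y, F (Function.update ω m ((ω m).1, y)) ∂ν ∂markedLaw r ν =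
      ∫⁻ ω, F ω ∂markedLaw r ν := by
  have := isProbabilityMeasure_expMeasure hr
  refine lintegral_infinitePi_update_map _ ν
    (g := fun q : (ℝ × Y) × Y => (q.1.1, q.2)) (by fun_prop) ?_ m hF
  refine (Measure.prod_eq fun s t hs ht => ?_).symm
  rw [Measure.map_apply (by fun_prop) (hs.prod ht)]
  have : (fun q : (ℝ × Y) × Y => (q.1.1, q.2)) ⁻¹' s ×ˢ t = (s ×ˢ Set.univ) ×ˢ t := by
    ext q; simp
  rw [this, Measure.prod_prod, Measure.prod_prod, measure_univ, mul_one]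

/-- The Markov property: given the path up to arrival `n + k`, the next gap and the next mark are
fresh, and averaging over them is `preemptOp`. -/
theorem lintegral_taggedState_succ (hr : 0 < r) [IsProbabilityMeasure ν] (hX : Measurable X)
    (hX' : Measurable X') (hS : Measurable S) (n k : ℕ) {f : ℝ × ℝ → ℝ≥0∞} (hf : Measurable f) :
    ∫⁻ ω, (taggedPresent X X' S n (k + 1)).indicator
        (fun ω => f (taggedState X X' S n (k + 1) ω)) ω ∂markedLaw r ν =
      ∫⁻ ω, (taggedPresent X X' S n k).indicator
        (fun ω => preemptOp r ν X' f (taggedState X X' S n k ω)) ω ∂markedLaw r ν := by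
  have := isProbabilityMeasure_expMeasure hr
  have hst := measurable_taggedState hX hX' hS n
  have hpr := measurableSet_taggedPresent hX hX' hS n
  -- The mark of arrival `n + k + 1` enters the new state but not the event of being present. It is
  -- integrated out first, and the gap `n + k` after it.
  rw [← lintegral_update_mark hr (n + k + 1)
    (F := fun ω => (taggedPresent X X' S n (k + 1)).indicator
      (fun ω => f (taggedState X X' S n (k + 1) ω)) ω) ((hf.comp (hst (k + 1))).indicator (hpr (k + 1)))]
  let G : (ℕ → ℝ × Y) → ℝ≥0∞ := fun ω => (taggedPresent X X' S n (k + 1)).indicator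
    (fun ω => ∫⁻ y, f (max 0 ((taggedState X X' S n k ω).1 - (ω (n + k)).1) + X' y,
        (taggedState X X' S n k ω).2 - min (taggedState X X' S n k ω).2
          (max 0 ((ω (n + k)).1 - (taggedState X X' S n k ω).1))) ∂ν) ω
  have hG : Measurable G := by
    refine Measurable.indicator ?_ (hpr (k + 1))
    have hk := hst k
    exact Measurable.lintegral_prod_right' (f := fun q : (ℕ → ℝ × Y) × Y =>
      f (max 0 ((taggedState X X' S n k q.1).1 - (q.1 (n + k)).1) + X' q.2,
        (taggedState X X' S n k q.1).2 - min (taggedState X X' S n k q.1).2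
          (max 0 ((q.1 (n + k)).1 - (taggedState X X' S n k q.1).1)))) (by fun_prop)
  trans ∫⁻ ω, G ω ∂markedLaw r ν
  · refine lintegral_congr fun ω => ?_
    have hupd (y : Y) : ∀ j < n + (k + 1), Function.update ω (n + k + 1) ((ω (n + k + 1)).1, y) j =
        ω j := fun j hj => Function.update_of_ne (by omega) _ _
    by_cases hω : ω ∈ taggedPresent X X' S n (k + 1)
    · simp only [G, Set.indicator_of_mem hω]
      refine lintegral_congr fun y => ?_
      rw [Set.indicator_of_mem ((mem_taggedPresent_congr (hupd y)).2 hω), taggedState,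
        taggedState_congr (ω' := ω) (fun j hj => hupd y j (by omega))
          (by rw [hupd y _ (by omega)]), hupd y _ (by omega), Function.update_self]
    · simp only [G, Set.indicator_of_notMem hω]
      rw [← lintegral_zero (μ := ν)]
      refine lintegral_congr fun y => ?_
      rw [Set.indicator_of_notMem fun h => hω ((mem_taggedPresent_congr (hupd y)).1 h)]
  · rw [← lintegral_update_gap hr (n + k) hG]
    refine lintegral_congr fun ω => ?_
    have hupd (a : ℝ) : ∀ j < n + k, Function.update ω (n + k) (a, (ω (n + k)).2) j =
        ω j := fun j hj => Function.update_of_ne (by omega) _ _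
    have hstate (a : ℝ) : taggedState X X' S n k
        (Function.update ω (n + k) (a, (ω (n + k)).2)) = taggedState X X' S n k ω :=
      taggedState_congr (hupd a) (by rw [Function.update_self])
    by_cases hω : ω ∈ taggedPresent X X' S n k
    · rw [Set.indicator_of_mem hω, preemptOp]
      refine lintegral_congr fun a => ?_
      have hmem : Function.update ω (n + k) (a, (ω (n + k)).2) ∈ taggedPresent X X' S n (k + 1) ↔
          a ∈ Set.Iio ((taggedState X X' S n k ω).1 + (taggedState X X' S n k ω).2) := by
        rw [mem_taggedPresent_succ, hstate, Function.update_self,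
          mem_taggedPresent_congr (hupd a), Set.mem_Iio]
        exact and_iff_right hω
      simp only [G]
      by_cases ha : a ∈ Set.Iio ((taggedState X X' S n k ω).1 + (taggedState X X' S n k ω).2)
      · rw [Set.indicator_of_mem (hmem.2 ha), Set.indicator_of_mem ha, hstate,
          Function.update_self]
      · rw [Set.indicator_of_notMem (fun h => ha (hmem.1 h)), Set.indicator_of_notMem ha]
    · rw [Set.indicator_of_notMem hω, ← lintegral_zero (μ := expMeasure r)]
      refine lintegral_congr fun a => ?_
      refine Set.indicator_of_notMem (fun h => hω ?_) _
      exact (mem_taggedPresent_congr (hupd a)).1 (mem_taggedPresent_succ.1 h).1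

theorem lintegral_taggedState (hr : 0 < r) [IsProbabilityMeasure ν] (hX : Measurable X)
    (hX' : Measurable X') (hS : Measurable S) (n k : ℕ) {f : ℝ × ℝ → ℝ≥0∞} (hf : Measurable f) :
    ∫⁻ ω, (taggedPresent X X' S n k).indicator
        (fun ω => f (taggedState X X' S n k ω)) ω ∂markedLaw r ν =
      ∫⁻ ω, (preemptOp r ν X')^[k] f (workloadFound X n ω, S (ω n).2) ∂markedLaw r ν := by
  induction k generalizing f with
  | zero =>
    refine lintegral_congr fun ω => ?_
    rw [Set.indicator_of_mem (by simp [taggedPresent])]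
    rfl
  | succ k ih =>
    rw [lintegral_taggedState_succ hr hX hX' hS n k hf, ih (measurable_preemptOp hr hX' hf),
      Function.iterate_succ_apply]

/-- The wait in an interval also depends on the gap that follows the current state. Averaging over
this independent gap turns it into a function of the state alone. -/
theorem lintegral_wait_taggedState (hr : 0 < r) [IsProbabilityMeasure ν] (hX : Measurable X)
    (hX' : Measurable X') (hS : Measurable S) (n k : ℕ) :
    ∫⁻ ω, (taggedPresent X X' S n k).indicator
        (fun ω => ENNReal.ofReal (min (ω (n + k)).1 (taggedState X X' S n k ω).1)) ω
        ∂markedLaw r ν =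
      ∫⁻ ω, (preemptOp r ν X')^[k] (fun p => ∫⁻ a, ENNReal.ofReal (min a p.1) ∂expMeasure r)
        (workloadFound X n ω, S (ω n).2) ∂markedLaw r ν := by
  have := isProbabilityMeasure_expMeasure hr
  have hst := measurable_taggedState hX hX' hS n k
  have hpr := measurableSet_taggedPresent hX hX' hS n k
  have hcm : Measurable fun p : ℝ × ℝ => ∫⁻ a, ENNReal.ofReal (min a p.1) ∂expMeasure r :=
    Measurable.lintegral_prod_right' (f := fun q : (ℝ × ℝ) × ℝ =>
      ENNReal.ofReal (min q.2 q.1.1)) (by fun_prop)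
  rw [← lintegral_taggedState hr hX hX' hS n k hcm,
    ← lintegral_update_gap hr (n + k) (F := fun ω => (taggedPresent X X' S n k).indicator
      (fun ω => ENNReal.ofReal (min (ω (n + k)).1 (taggedState X X' S n k ω).1)) ω)
      (Measurable.indicator (by fun_prop) hpr)]
  refine lintegral_congr fun ω => ?_
  have hupd (a : ℝ) : ∀ j < n + k, Function.update ω (n + k) (a, (ω (n + k)).2) j =
      ω j := fun j hj => Function.update_of_ne (by omega) _ _
  have hstate (a : ℝ) : taggedState X X' S n k
      (Function.update ω (n + k) (a, (ω (n + k)).2)) = taggedState X X' S n k ω :=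
    taggedState_congr (hupd a) (by rw [Function.update_self])
  by_cases hω : ω ∈ taggedPresent X X' S n k
  · rw [Set.indicator_of_mem hω]
    refine lintegral_congr fun a => ?_
    rw [Set.indicator_of_mem ((mem_taggedPresent_congr (hupd a)).2 hω), hstate,
      Function.update_self]
  · rw [Set.indicator_of_notMem hω, ← lintegral_zero (μ := expMeasure r)]
    exact lintegral_congr fun a => Set.indicator_of_notMem
      (fun h => hω ((mem_taggedPresent_congr (hupd a)).1 h)) _

/-- The expected waiting time of customer `n` in terms of the expected workload it finds. -/
theorem lintegral_tsum_wait_taggedState (hr : 0 < r) [IsProbabilityMeasure ν] (hX : Measurable X)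
    (hX' : Measurable X') (hS : Measurable S) (hX0 : ∀ᵐ y ∂ν, 0 ≤ X' y) (hS0 : ∀ᵐ y ∂ν, 0 ≤ S y)
    {x₁ x₂ s : ℝ} (hx₁ : 0 ≤ x₁) (hx₂ : 0 ≤ x₂)
    (h₁ : ∫⁻ y, ENNReal.ofReal (X' y) ∂ν = ENNReal.ofReal x₁)
    (h₂ : ∫⁻ y, ENNReal.ofReal (X' y ^ 2) ∂ν = ENNReal.ofReal x₂)
    (hs₁ : ∫⁻ y, ENNReal.ofReal (S y) ∂ν = ENNReal.ofReal s) (hρ : r * x₁ < 1) (n : ℕ) :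
    ∫⁻ ω, ∑' k, (taggedPresent X X' S n k).indicator
        (fun ω => ENNReal.ofReal (min (ω (n + k)).1 (taggedState X X' S n k ω).1)) ω
        ∂markedLaw r ν =
      ENNReal.ofReal (1 - r * x₁)⁻¹ *
        (lindleyMoment r ν X 1 n + ENNReal.ofReal (r * x₁ * s)) := by
  have := isProbabilityMeasure_expMeasure hr
  have hst := measurable_taggedState hX hX' hS n
  have hpr := measurableSet_taggedPresent hX hX' hS n
  have hw := measurable_workloadFound hX n
  have hd : 0 < 1 - r * x₁ := by linarith
  have hcm : Measurable fun p : ℝ × ℝ => ∫⁻ a, ENNReal.ofReal (min a p.1) ∂expMeasure r :=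
    Measurable.lintegral_prod_right' (f := fun q : (ℝ × ℝ) × ℝ =>
      ENNReal.ofReal (min q.2 q.1.1)) (by fun_prop)
  -- Sum and integral are exchanged to apply the Markov property term by term, and exchanged back so
  -- that the sum can be evaluated pathwise.
  rw [lintegral_tsum fun k => by
    have := hst k
    exact (Measurable.indicator (by fun_prop) (hpr k)).aemeasurable]
  simp only [lintegral_wait_taggedState hr hX hX' hS]
  rw [← lintegral_tsum fun k => by
    have := measurable_iterate_preemptOp (ν := ν) hr hX' hcm k
    exact Measurable.aemeasurable (by fun_prop)]
  have heval : MeasurePreserving (fun ω : ℕ → ℝ × Y => (ω n).2) (markedLaw r ν) ν :=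
    (measurePreserving_snd (μ := expMeasure r) (ν := ν)).comp
      (measurePreserving_eval_infinitePi (fun _ : ℕ => (expMeasure r).prod ν) n)
  have hae : ∀ᵐ ω ∂markedLaw r ν, ∑' k, (preemptOp r ν X')^[k]
      (fun p => ∫⁻ a, ENNReal.ofReal (min a p.1) ∂expMeasure r) (workloadFound X n ω, S (ω n).2) =
      ENNReal.ofReal (1 - r * x₁)⁻¹ * (ENNReal.ofReal (workloadFound X n ω) +
        ENNReal.ofReal (r * x₁) * ENNReal.ofReal (S (ω n).2)) := by
    filter_upwards [heval.quasiMeasurePreserving.ae hS0] with ω hω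
    have hv : 0 ≤ workloadFound X n ω := PRQueue.lindley_nonneg _ _ _
    rw [tsum_iterate_preemptOp hr hX' hX0 hx₁ hx₂ h₁ h₂ hρ _ hv hω,
      ← ENNReal.ofReal_mul (by positivity), ← ENNReal.ofReal_add hv (by positivity),
      ← ENNReal.ofReal_mul (by positivity)]
    congr 1
    rw [div_eq_inv_mul]
  rw [lintegral_congr_ae hae, lintegral_const_mul _ (by fun_prop), lintegral_add_left (by fun_prop),
    lintegral_const_mul _ (by fun_prop), lintegral_workloadFound hr hX n (by fun_prop),
    heval.lintegral_comp (f := fun y => ENNReal.ofReal (S y)) (by fun_prop), hs₁,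
    ← ENNReal.ofReal_mul (by positivity)]
  simp only [lindleyMoment, pow_one]

end Tagged

/-! ### Matching the queue with the tagged-customer chain -/

namespace PRQueue

/-- The work ahead of a class `c` customer brought by an earlier customer with (service
requirement, class) `y`. -/
def earlierInput (c : Bool) (y : ℝ × Bool) : ℝ := if c = true ∧ y.2 = false then 0 else y.1

/-- The work ahead of a class `c` customer brought by a later customer with (service
requirement, class) `y`. -/
def laterInput (c : Bool) (y : ℝ × Bool) : ℝ := if c = false ∧ y.2 = true then y.1 else 0

theorem measurable_earlierInput (c : Bool) : Measurable (earlierInput c) :=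
  Measurable.ite ((MeasurableSet.const _).inter (measurable_snd (measurableSet_singleton false)))
    measurable_const measurable_fst

theorem measurable_laterInput (c : Bool) : Measurable (laterInput c) :=
  Measurable.ite ((MeasurableSet.const _).inter (measurable_snd (measurableSet_singleton true)))
    measurable_fst measurable_const

variable {ω : ℕ → ℝ × ℝ × Bool} {n : ℕ} {c : Bool}

theorem priorityInput_of_lt {m : ℕ} (hm : m < n) :
    priorityInput (fun k => (ω k).2.1) (Function.update (fun k => (ω k).2.2) n c) n m =
      earlierInput c (ω m).2 := by
  simp only [priorityInput, earlierInput, HasPriority, Function.update_self,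
    Function.update_of_ne hm.ne]
  cases c <;> cases h : (ω m).2.2 <;> simp [hm]

theorem priorityInput_self :
    priorityInput (fun k => (ω k).2.1) (Function.update (fun k => (ω k).2.2) n c) n n = 0 := by
  simp only [priorityInput, HasPriority, Function.update_self]
  cases c <;> simp

theorem priorityInput_of_gt {m : ℕ} (hm : n < m) :
    priorityInput (fun k => (ω k).2.1) (Function.update (fun k => (ω k).2.2) n c) n m =
      laterInput c (ω m).2 := by
  simp only [priorityInput, laterInput, HasPriority, Function.update_self,
    Function.update_of_ne hm.ne']
  cases c <;> cases h : (ω m).2.2 <;> simp [hm.le]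

theorem taggedState_eq (k : ℕ) :
    taggedState (earlierInput c) (laterInput c) Prod.fst n k ω =
      (lindley (fun k => (ω k).1) (priorityInput (fun k => (ω k).2.1)
        (Function.update (fun k => (ω k).2.2) n c) n) (n + k) + priorityInput (fun k => (ω k).2.1)
        (Function.update (fun k => (ω k).2.2) n c) n (n + k),
      residual (fun k => (ω k).1) (fun k => (ω k).2.1)
        (Function.update (fun k => (ω k).2.2) n c) n k) := by
  induction k with
  | zero =>
    rw [taggedState, add_zero, priorityInput_self, add_zero, residual, workloadFound]
    refine Prod.ext ?_ rfl
    exact lindley_congr (fun _ _ => rfl) fun k hk => (priorityInput_of_lt hk).symm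
  | succ k ih =>
    rw [taggedState, ih, residual, ← add_assoc, lindley, priorityInput_of_gt (m := n + k + 1)
      (by omega)]

theorem wait_eq_tsum_taggedState (hs : ∀ k, 0 ≤ (ω k).2.1) (hg : ∀ k, 0 ≤ (ω k).1) :
    wait (fun k => (ω k).1) (fun k => (ω k).2.1) (Function.update (fun k => (ω k).2.2) n c) n =
      ∑' k, (taggedPresent (earlierInput c) (laterInput c) Prod.fst n k).indicator
        (fun ω => ENNReal.ofReal (min (ω (n + k)).1
          (taggedState (earlierInput c) (laterInput c) Prod.fst n k ω).1)) ω := by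
  classical
  rw [wait_eq hs hg]
  refine tsum_congr fun k => ?_
  rw [Set.indicator_apply]
  have hiff : ω ∈ taggedPresent (earlierInput c) (laterInput c) Prod.fst n k ↔
      Present (fun k => (ω k).1) (fun k => (ω k).2.1)
        (Function.update (fun k => (ω k).2.2) n c) n k := by
    refine forall₂_congr fun j _ => ?_
    rw [taggedState_eq]
  simp only [hiff, taggedState_eq]

end PRQueue

/-! ### Closed form of the steady-state mean waits -/

namespace MG1

open PRQueue

variable (M : MG1) (φ : unitInterval)

/-- The law of the pair (service requirement, class). -/
def markLaw : Measure (ℝ × Bool) := M.service.prod (bernoulliMeasure true false φ)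

instance : IsProbabilityMeasure M.service := M.isProbabilityMeasure_service

instance : IsProbabilityMeasure (M.markLaw φ) := by unfold markLaw; infer_instance

/-- The mean service time. -/
def meanService : ℝ := ∫ s, s ∂M.service

/-- The second moment of the service time. -/
def sqService : ℝ := ∫ s, s ^ 2 ∂M.service

theorem meanService_pos : 0 < M.meanService := M.mean_pos

theorem sq_meanService_le : M.meanService ^ 2 ≤ M.sqService := by
  have := ProbabilityTheory.variance_nonneg id M.service
  rw [ProbabilityTheory.variance_eq_sub M.memLp_service] at this
  simpa [meanService, sqService] using this

theorem sqService_pos : 0 < M.sqService :=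
  (pow_pos M.meanService_pos 2).trans_le M.sq_meanService_le

theorem lintegral_service : ∫⁻ s, ENNReal.ofReal s ∂M.service = ENNReal.ofReal M.meanService :=
  (ofReal_integral_eq_lintegral_ofReal (M.memLp_service.integrable one_le_two)
    M.service_nonneg).symm

theorem lintegral_sq_service :
    ∫⁻ s, ENNReal.ofReal (s ^ 2) ∂M.service = ENNReal.ofReal M.sqService :=
  (ofReal_integral_eq_lintegral_ofReal M.memLp_service.integrable_sq
    (ae_of_all _ fun s => sq_nonneg s)).symm

theorem lintegral_markLaw {F : ℝ × Bool → ℝ≥0∞} (hF : Measurable F) :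
    ∫⁻ y, F y ∂M.markLaw φ = ENNReal.ofReal φ * ∫⁻ s, F (s, true) ∂M.service +
      ENNReal.ofReal (1 - φ) * ∫⁻ s, F (s, false) ∂M.service := by
  have h1 : ((unitInterval.toNNReal φ : NNReal) : ℝ≥0∞) = ENNReal.ofReal φ := by
    rw [ENNReal.ofReal, Real.toNNReal_of_nonneg φ.2.1]; rfl
  have h2 : ((unitInterval.toNNReal (unitInterval.symm φ) : NNReal) : ℝ≥0∞) =
      ENNReal.ofReal (1 - φ) := by
    rw [ENNReal.ofReal, Real.toNNReal_of_nonneg (sub_nonneg.2 φ.2.2)]; rfl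
  rw [markLaw, lintegral_prod _ hF.aemeasurable, ← lintegral_const_mul _ (by fun_prop),
    ← lintegral_const_mul _ (by fun_prop), ← lintegral_add_left (by fun_prop)]
  refine lintegral_congr fun s => ?_
  rw [bernoulliMeasure_def, lintegral_add_measure, lintegral_smul_measure, lintegral_smul_measure,
    lintegral_dirac, lintegral_dirac, ← h1, ← h2]
  rfl

theorem lintegral_fst_markLaw {f : ℝ → ℝ≥0∞} (hf : Measurable f) :
    ∫⁻ y, f y.1 ∂M.markLaw φ = ∫⁻ s, f s ∂M.service := by
  rw [M.lintegral_markLaw φ (by fun_prop), ← add_mul,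
    ← ENNReal.ofReal_add φ.2.1 (sub_nonneg.2 φ.2.2)]
  simp

theorem ae_nonneg_markLaw : ∀ᵐ y ∂M.markLaw φ, 0 ≤ y.1 :=
  (Measure.quasiMeasurePreserving_fst (μ := M.service)
    (ν := bernoulliMeasure true false φ)).ae M.service_nonneg

/-- The fraction of earlier customers that are ahead of a class `c` customer. -/
def earlierFraction (c : Bool) : ℝ := if c then φ else 1

/-- The fraction of later customers that overtake a class `c` customer. -/
def laterFraction (c : Bool) : ℝ := if c then 0 else φ

theorem earlierFraction_nonneg (c : Bool) : 0 ≤ earlierFraction φ c := by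
  unfold earlierFraction; split_ifs; exacts [φ.2.1, zero_le_one]

theorem laterFraction_nonneg (c : Bool) : 0 ≤ laterFraction φ c := by
  unfold laterFraction; split_ifs; exacts [le_rfl, φ.2.1]

theorem earlierFraction_le_one (c : Bool) : earlierFraction φ c ≤ 1 := by
  unfold earlierFraction; split_ifs; exacts [φ.2.2, le_rfl]

theorem laterFraction_le_one (c : Bool) : laterFraction φ c ≤ 1 := by
  unfold laterFraction; split_ifs; exacts [zero_le_one, φ.2.2]

/-- Customers without priority bring input `0`, where `f` vanishes. Only the fraction with priority
contributes, with the service law. -/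
theorem lintegral_earlierInput (c : Bool) {f : ℝ → ℝ≥0∞} (hf : Measurable f) (hf0 : f 0 = 0) :
    ∫⁻ y, f (earlierInput c y) ∂M.markLaw φ =
      ENNReal.ofReal (earlierFraction φ c) * ∫⁻ s, f s ∂M.service := by
  cases c
  · simp [earlierInput, earlierFraction, M.lintegral_fst_markLaw φ hf]
  · rw [M.lintegral_markLaw φ (F := fun y => f (earlierInput true y))
      (hf.comp (measurable_earlierInput _))]
    simp [earlierInput, earlierFraction, hf0]

theorem lintegral_laterInput (c : Bool) {f : ℝ → ℝ≥0∞} (hf : Measurable f) (hf0 : f 0 = 0) :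
    ∫⁻ y, f (laterInput c y) ∂M.markLaw φ =
      ENNReal.ofReal (laterFraction φ c) * ∫⁻ s, f s ∂M.service := by
  rw [M.lintegral_markLaw φ (F := fun y => f (laterInput c y))
    (hf.comp (measurable_laterInput _))]
  cases c <;> simp [laterInput, laterFraction, hf0]

theorem law_eq_markedLaw : M.law φ = markedLaw M.arrivalRate (M.markLaw φ) := rfl

theorem mul_meanService_lt_one {x : ℝ} (hx1 : x ≤ 1) :
    M.arrivalRate * (x * M.meanService) < 1 := by
  have h : M.arrivalRate * M.meanService < 1 := M.load_lt_one
  have h' : 0 < M.arrivalRate * M.meanService := mul_pos M.arrivalRate_pos M.meanService_pos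
  nlinarith

/-- Gaps and service times are nonnegative almost surely, so the pathwise reduction to the tagged
customer applies under the integral. -/
theorem expectedWait_eq (c : Bool) (n : ℕ) :
    M.expectedWait φ c n =
      ENNReal.ofReal (1 - M.arrivalRate * (laterFraction φ c * M.meanService))⁻¹ *
        (lindleyMoment M.arrivalRate (M.markLaw φ) (earlierInput c) 1 n +
          ENNReal.ofReal (M.arrivalRate * (laterFraction φ c * M.meanService) *
            M.meanService)) := by
  have hr := M.arrivalRate_pos
  have hm := M.meanService_pos
  have hq := M.sqService_pos
  have := isProbabilityMeasure_expMeasure hr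
  have hl := laterFraction_nonneg φ c
  rw [← lintegral_tsum_wait_taggedState (S := Prod.fst) (X' := laterInput c) hr
    (measurable_earlierInput c) (measurable_laterInput c) measurable_fst
    (x₂ := laterFraction φ c * M.sqService) ?_ (M.ae_nonneg_markLaw φ) (by positivity)
    (by positivity) ?_ ?_ ?_ (M.mul_meanService_lt_one (laterFraction_le_one φ c)) n]
  · rw [expectedWait, law_eq_markedLaw]
    refine lintegral_congr_ae ?_
    have hev (k : ℕ) : MeasurePreserving (fun ω : ℕ → ℝ × ℝ × Bool => ω k)
        (markedLaw M.arrivalRate (M.markLaw φ)) ((expMeasure M.arrivalRate).prod (M.markLaw φ)) :=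
      measurePreserving_eval_infinitePi _ k
    have hg : ∀ᵐ ω ∂markedLaw M.arrivalRate (M.markLaw φ), ∀ k, 0 ≤ (ω k).1 :=
      ae_all_iff.2 fun k => (hev k).quasiMeasurePreserving.ae
        (Measure.quasiMeasurePreserving_fst.ae (ae_nonneg_expMeasure _))
    have hs : ∀ᵐ ω ∂markedLaw M.arrivalRate (M.markLaw φ), ∀ k, 0 ≤ (ω k).2.1 :=
      ae_all_iff.2 fun k => (hev k).quasiMeasurePreserving.ae
        (Measure.quasiMeasurePreserving_snd.ae (M.ae_nonneg_markLaw φ))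
    filter_upwards [hg, hs] with ω h1 h2
    exact wait_eq_tsum_taggedState h2 h1
  · refine (M.ae_nonneg_markLaw φ).mono fun y hy => ?_
    unfold laterInput
    split_ifs
    exacts [hy, le_rfl]
  · rw [M.lintegral_laterInput φ c (f := fun s => ENNReal.ofReal s) (by fun_prop) (by simp),
      M.lintegral_service, ← ENNReal.ofReal_mul hl]
  · rw [M.lintegral_laterInput φ c (f := fun s => ENNReal.ofReal (s ^ 2)) (by fun_prop) (by simp),
      M.lintegral_sq_service, ← ENNReal.ofReal_mul hl]
  · rw [M.lintegral_fst_markLaw φ (f := fun s => ENNReal.ofReal s) (by fun_prop),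
      M.lintegral_service]

/-- The steady-state expected waiting time in class `c`, in closed form. -/
def waitFormula (c : Bool) : ℝ :=
  (1 - M.arrivalRate * (laterFraction φ c * M.meanService))⁻¹ *
    (M.arrivalRate * (earlierFraction φ c * M.sqService) /
      (2 * (1 - M.arrivalRate * (earlierFraction φ c * M.meanService))) +
      M.arrivalRate * (laterFraction φ c * M.meanService) * M.meanService)

theorem tendsto_expectedWait (c : Bool) :
    Tendsto (M.expectedWait φ c) atTop (𝓝 (ENNReal.ofReal (M.waitFormula φ c))) := by
  have hr := M.arrivalRate_pos
  have hm := M.meanService_pos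
  have hq := M.sqService_pos
  have hl := laterFraction_nonneg φ c
  have he := earlierFraction_nonneg φ c
  have hl1 := M.mul_meanService_lt_one (laterFraction_le_one φ c)
  have he1 := M.mul_meanService_lt_one (earlierFraction_le_one φ c)
  have hX0 : ∀ᵐ y ∂M.markLaw φ, 0 ≤ earlierInput c y := by
    refine (M.ae_nonneg_markLaw φ).mono fun y hy => ?_
    unfold earlierInput
    split_ifs
    exacts [le_rfl, hy]
  have h := tendsto_lindleyMoment_one hr (measurable_earlierInput c) hX0
    (x₁ := earlierFraction φ c * M.meanService) (x₂ := earlierFraction φ c * M.sqService)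
    (by positivity) (by positivity)
    (by rw [M.lintegral_earlierInput φ c (f := fun s => ENNReal.ofReal s) (by fun_prop) (by simp),
      M.lintegral_service, ← ENNReal.ofReal_mul he])
    (by rw [M.lintegral_earlierInput φ c (f := fun s => ENNReal.ofReal (s ^ 2)) (by fun_prop)
      (by simp), M.lintegral_sq_service, ← ENNReal.ofReal_mul he]) he1
  have hd : 0 < 1 - M.arrivalRate * (laterFraction φ c * M.meanService) := by linarith
  have hd' : 0 < 1 - M.arrivalRate * (earlierFraction φ c * M.meanService) := by linarith
  rw [waitFormula, ENNReal.ofReal_mul (by positivity), ENNReal.ofReal_add (by positivity)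
    (by positivity), funext (M.expectedWait_eq φ c)]
  exact ENNReal.Tendsto.const_mul (h.add tendsto_const_nhds) (Or.inr ENNReal.ofReal_ne_top)

theorem waitFormula_nonneg (c : Bool) : 0 ≤ M.waitFormula φ c := by
  have hr := M.arrivalRate_pos
  have hm := M.meanService_pos
  have hq := M.sqService_pos
  have hl := laterFraction_nonneg φ c
  have he := earlierFraction_nonneg φ c
  have hd : 0 < 1 - M.arrivalRate * (laterFraction φ c * M.meanService) := by
    linarith [M.mul_meanService_lt_one (laterFraction_le_one φ c)]
  have hd' : 0 < 1 - M.arrivalRate * (earlierFraction φ c * M.meanService) := by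
    linarith [M.mul_meanService_lt_one (earlierFraction_le_one φ c)]
  unfold waitFormula
  positivity

theorem meanWait_eq (c : Bool) : M.meanWait φ c = M.waitFormula φ c := by
  rw [meanWait, (M.tendsto_expectedWait φ c).limsup_eq,
    ENNReal.toReal_ofReal (M.waitFormula_nonneg φ c)]

theorem tendsto_expectedWait_meanWait (c : Bool) :
    Tendsto (M.expectedWait φ c) atTop (𝓝 (ENNReal.ofReal (M.meanWait φ c))) := by
  rw [meanWait_eq]
  exact M.tendsto_expectedWait φ c

end MG1

namespace MG1

/-! ### Equilibria and the price of anarchy -/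

section PriceOfAnarchy

variable (M : MG1) (φ : unitInterval)

theorem continuous_meanWait (c : Bool) : Continuous fun φ => M.meanWait φ c := by
  have he (φ : unitInterval) : 1 - M.arrivalRate * (earlierFraction φ c * M.meanService) ≠ 0 := by
    linarith [M.mul_meanService_lt_one (earlierFraction_le_one φ c)]
  have hl (φ : unitInterval) : 1 - M.arrivalRate * (laterFraction φ c * M.meanService) ≠ 0 := by
    linarith [M.mul_meanService_lt_one (laterFraction_le_one φ c)]
  have hce : Continuous fun φ => earlierFraction φ c := by
    unfold earlierFraction; split_ifs <;> fun_prop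
  have hcl : Continuous fun φ => laterFraction φ c := by
    unfold laterFraction; split_ifs <;> fun_prop
  simp only [meanWait_eq, waitFormula]
  refine Continuous.mul (Continuous.inv₀ (by fun_prop) hl) ?_
  exact (Continuous.div (by fun_prop) (by fun_prop) fun φ => by simpa using he φ).add
    (by fun_prop)

theorem continuous_overallMeanWait : Continuous M.overallMeanWait := by
  have h1 := M.continuous_meanWait true
  have h2 := M.continuous_meanWait false
  unfold overallMeanWait
  fun_prop

/-- Each equilibrium condition is an implication from an open condition to a closed one, hence
closed. This gives compactness, so that the worst equilibrium is attained. -/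
theorem isClosed_equilibria (C : ℝ) : IsClosed {φ | M.IsEquilibrium C φ} := by
  have h1 := M.continuous_meanWait true
  have h2 := M.continuous_meanWait false
  exact (isClosed_imp (isOpen_lt (by fun_prop) (by fun_prop))
    (isClosed_le (by fun_prop) (by fun_prop))).inter
    (isClosed_imp (isOpen_lt (by fun_prop) (by fun_prop))
    (isClosed_le (by fun_prop) (by fun_prop)))

/-- If neither endpoint is an equilibrium, the advantage of the premium class exceeds `C` at `0` and
is below `C` at `1`; by continuity it equals `C` somewhere between. -/
theorem exists_isEquilibrium (C : ℝ) : ∃ φ, M.IsEquilibrium C φ := by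
  have h1 := M.continuous_meanWait true
  have h2 := M.continuous_meanWait false
  by_cases h0 : M.meanWait 0 false ≤ M.meanWait 0 true + C
  · exact ⟨0, fun h => absurd h (lt_irrefl _), fun _ => h0⟩
  by_cases h1' : M.meanWait 1 true + C ≤ M.meanWait 1 false
  · exact ⟨1, fun _ => h1', fun h => absurd h (lt_irrefl _)⟩
  obtain ⟨φ, hφ⟩ := mem_range_of_exists_le_of_exists_ge (c := C)
    (f := fun φ => M.meanWait φ false - M.meanWait φ true) (h2.sub h1)
    ⟨1, by linarith⟩ ⟨0, by linarith⟩
  simp only at hφ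
  exact ⟨φ, fun _ => by linarith, fun _ => by linarith⟩

theorem load_eq : M.load = M.arrivalRate * M.meanService := by
  rw [load, serviceRate, div_inv_eq_mul]; rfl

theorem load_pos : 0 < M.load := by
  rw [load_eq]; exact mul_pos M.arrivalRate_pos M.meanService_pos

theorem load_lt : M.load < 1 := by rw [load_eq]; exact M.load_lt_one

theorem sqService_eq : M.sqService = M.varianceParam * M.meanService ^ 2 := by
  have := M.meanService_pos.ne'
  change M.sqService = M.sqService * M.meanService⁻¹ ^ 2 * M.meanService ^ 2
  field_simp

theorem one_le_varianceParam : 1 ≤ M.varianceParam := by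
  have h := M.sq_meanService_le
  rw [sqService_eq] at h
  have := pow_pos M.meanService_pos 2
  nlinarith

/-- The expected waiting time without priorities. -/
def fcfsWait : ℝ := M.meanService * M.load * M.varianceParam / (2 * (1 - M.load))

theorem fcfsWait_pos : 0 < M.fcfsWait := by
  have h1 := M.meanService_pos
  have h2 := M.load_pos
  have h3 := sub_pos.2 M.load_lt
  have h4 := zero_lt_one.trans_le M.one_le_varianceParam
  unfold fcfsWait
  positivity

theorem meanWait_true : M.meanWait φ true =
    M.meanService * M.load * φ * M.varianceParam / (2 * (1 - φ * M.load)) := by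
  rw [meanWait_eq, waitFormula, sqService_eq, load_eq]
  simp only [laterFraction, earlierFraction, if_true, zero_mul, mul_zero, sub_zero, inv_one,
    one_mul, add_zero]
  congr 1 <;> ring

theorem meanWait_false : M.meanWait φ false =
    (M.fcfsWait + φ * M.load * M.meanService) / (1 - φ * M.load) := by
  rw [meanWait_eq, waitFormula, fcfsWait, sqService_eq, load_eq]
  simp only [laterFraction, earlierFraction, one_mul, Bool.false_eq_true, if_false]
  rw [div_eq_inv_mul (_ + _)]
  congr 1
  · ring
  · ring

/-- The overall expected waiting time relative to the one without priorities. -/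
theorem overallMeanWait_eq : M.overallMeanWait φ = M.fcfsWait *
    (1 + (2 / M.varianceParam - 1) * ((φ * (1 - φ)) * (1 - M.load) / (1 - φ * M.load))) := by
  have h1 := M.meanService_pos
  have h2 := M.load_pos
  have h3 : 1 - M.load ≠ 0 := (sub_pos.2 M.load_lt).ne'
  have h4 := (zero_lt_one.trans_le M.one_le_varianceParam).ne'
  have h5 : 1 - φ * M.load ≠ 0 := by
    have := M.load_lt
    have h6 := φ.2.2
    nlinarith [φ.2.1]
  rw [overallMeanWait, meanWait_true, meanWait_false, fcfsWait]
  field_simp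
  ring

/-- The upper bound combines `φ(1-φ) ≤ 1/4` with `1 - ρ ≤ 1 - φρ`. -/
theorem priority_effect_bounds :
    0 ≤ (φ * (1 - φ)) * (1 - M.load) / (1 - φ * M.load) ∧
      (φ * (1 - φ)) * (1 - M.load) / (1 - φ * M.load) ≤ 1 / 4 := by
  have h1 := φ.2.1
  have h2 := φ.2.2
  have h3 := M.load_pos
  have h4 := M.load_lt
  have h6 : 1 - M.load ≤ 1 - φ * M.load := by nlinarith
  have h5 : 0 < 1 - φ * M.load := by linarith
  constructor
  · exact div_nonneg (mul_nonneg (mul_nonneg h1 (by linarith)) (by linarith)) h5.le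
  · rw [div_le_iff₀ h5]
    have : (φ : ℝ) * (1 - φ) ≤ 1 / 4 := by nlinarith [sq_nonneg ((φ : ℝ) - 1 / 2)]
    calc (φ : ℝ) * (1 - φ) * (1 - M.load) ≤ 1 / 4 * (1 - M.load) :=
          mul_le_mul_of_nonneg_right this (by linarith)
      _ ≤ _ := by linarith

theorem overallMeanWait_pos : 0 < M.overallMeanWait φ := by
  obtain ⟨h1, h2⟩ := M.priority_effect_bounds φ
  have h3 : 0 < 2 / M.varianceParam :=
    div_pos two_pos (zero_lt_one.trans_le M.one_le_varianceParam)
  rw [overallMeanWait_eq]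
  exact mul_pos M.fcfsWait_pos (by nlinarith)

theorem overallMeanWait_le (ψ : unitInterval) :
    M.overallMeanWait φ ≤ 4 / 3 * M.overallMeanWait ψ := by
  obtain ⟨h1, h2⟩ := M.priority_effect_bounds φ
  obtain ⟨h3, h4⟩ := M.priority_effect_bounds ψ
  have hK := M.one_le_varianceParam
  have h5 : 0 < 2 / M.varianceParam := div_pos two_pos (zero_lt_one.trans_le hK)
  have h6 : 2 / M.varianceParam ≤ 2 := div_le_self two_pos.le hK
  rw [overallMeanWait_eq, overallMeanWait_eq, mul_left_comm]
  refine mul_le_mul_of_nonneg_left ?_ M.fcfsWait_pos.le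
  set b := 2 / M.varianceParam - 1
  -- For `b ≤ 0` the extreme ratio is `1 / (1 - 1/4) = 4/3`; for `b ≥ 0` it is at most `5/4`.
  rcases le_total 0 b with hb | hb <;> nlinarith

theorem exists_isPriceOfAnarchy (C : ℝ) : ∃ r, M.IsPriceOfAnarchy C r := by
  obtain ⟨a, ha⟩ := ((M.isClosed_equilibria C).isCompact.image
    M.continuous_overallMeanWait).exists_isGreatest
    ((show {φ | M.IsEquilibrium C φ}.Nonempty from M.exists_isEquilibrium C).image _)
  obtain ⟨b, hb⟩ := (isCompact_range M.continuous_overallMeanWait).exists_isLeast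
    (Set.range_nonempty _)
  obtain ⟨ψ, hψ⟩ := hb.1
  exact ⟨a / b, a, b, ha, hb, hψ ▸ M.overallMeanWait_pos ψ, rfl⟩

variable {M}

theorem IsPriceOfAnarchy.le_four_thirds {C r : ℝ} (h : M.IsPriceOfAnarchy C r) : r ≤ 4 / 3 := by
  obtain ⟨a, b, ⟨⟨φ, -, rfl⟩, -⟩, ⟨⟨ψ, rfl⟩, -⟩, hb, rfl⟩ := h
  rw [div_le_iff₀ hb]
  exact M.overallMeanWait_le φ ψ

theorem IsPriceOfAnarchy.div_le {C r : ℝ} (h : M.IsPriceOfAnarchy C r) {φ ψ : unitInterval}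
    (hφ : M.IsEquilibrium C φ) : M.overallMeanWait φ / M.overallMeanWait ψ ≤ r := by
  obtain ⟨a, b, ha, hb, hb0, rfl⟩ := h
  have h1 := ha.2 (Set.mem_image_of_mem _ hφ)
  have h2 := hb.2 (Set.mem_range_self ψ)
  exact div_le_div₀ ((M.overallMeanWait_pos φ).le.trans h1) h1 hb0 h2

variable (M)

/-- When nobody is premium, a premium deviator does not wait at all and an ordinary customer waits
`fcfsWait`, so this fee makes both classes equally costly. -/
theorem isEquilibrium_zero : M.IsEquilibrium M.fcfsWait 0 := by
  refine ⟨fun h => absurd h (lt_irrefl _), fun _ => ?_⟩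
  rw [meanWait_true, meanWait_false]
  simp

theorem lt_of_isPriceOfAnarchy_fcfsWait {r ε : ℝ} (hε : 0 < ε) (hρ : M.load < ε)
    (hK : 2 + 2 / ε < M.varianceParam) (h : M.IsPriceOfAnarchy M.fcfsWait r) :
    4 / 3 - ε < r := by
  -- The value `1/2` maximizes `φ(1-φ)`, which is the limit of the priority effect as the load tends
  -- to `0`.
  let ψ : unitInterval := ⟨1 / 2, by norm_num, by norm_num⟩
  refine lt_of_lt_of_le ?_ (h.div_le (ψ := ψ) M.isEquilibrium_zero)
  have hρ0 := M.load_pos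
  have hρ1 := M.load_lt
  have hA := M.fcfsWait_pos
  have h2ε : 0 < 2 / ε := by positivity
  have hK0 : 0 < M.varianceParam := by linarith
  have hb1 : 2 / M.varianceParam < 1 := by rw [div_lt_one hK0]; linarith
  have hb0 : 0 < 2 / M.varianceParam := by positivity
  have hbε : 2 / M.varianceParam < ε := by
    rw [div_lt_iff₀ hK0]
    calc (2 : ℝ) = ε * (2 / ε) := by field_simp
      _ < ε * M.varianceParam := mul_lt_mul_of_pos_left (by linarith) hε
  have hpos := M.overallMeanWait_pos ψ
  rw [lt_div_iff₀ hpos]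
  rw [overallMeanWait_eq, overallMeanWait_eq] at *
  have hψ : (ψ : ℝ) = 1 / 2 := rfl
  simp only [hψ, Set.Icc.coe_zero, zero_mul, zero_div, mul_zero, add_zero, mul_one] at *
  set d := 2 / M.varianceParam
  set ρ := M.load
  have ht : (1 - ρ) / 4 ≤ 1 / 2 * (1 - 1 / 2) * (1 - ρ) / (1 - 1 / 2 * ρ) := by
    rw [le_div_iff₀ (by linarith)]
    nlinarith
  set t := 1 / 2 * (1 - 1 / 2) * (1 - ρ) / (1 - 1 / 2 * ρ)
  have h1 : 1 + (d - 1) * t ≤ 3 / 4 + (d + ρ) / 4 := by nlinarith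
  have h2 : 0 < 1 + (d - 1) * t := pos_of_mul_pos_right hpos hA.le
  rw [mul_left_comm]
  refine mul_lt_of_lt_one_right hA ?_
  rcases le_total (4 / 3 - ε) 0 with h3 | h3
  · exact (mul_nonpos_of_nonpos_of_nonneg h3 h2.le).trans_lt one_pos
  · refine (mul_le_mul_of_nonneg_left h1 h3).trans_lt ?_
    -- With `d + ρ < 2ε` the product is below `(4/3 - ε)(3/4 + ε/2) = 1 - ε/12 - ε²/2`.
    nlinarith

end PriceOfAnarchy

/-- Queues of arbitrarily small load and arbitrarily large variance parameter exist. -/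
theorem exists_load_lt_varianceParam_gt {ρ₀ : ℝ} (hρ₀ : 0 < ρ₀) (K₀ : ℝ) :
    ∃ M : MG1, M.load < ρ₀ ∧ K₀ < M.varianceParam := by
  have hN : 1 ≤ |K₀| + 1 := by linarith [abs_nonneg K₀]
  have hKN : K₀ < |K₀| + 1 := by linarith [le_abs_self K₀]
  set N := |K₀| + 1
  have hN0 : 0 < N := by linarith
  -- Service takes the value `N` with probability `1/N` and `0` otherwise: mean `1`, second moment
  -- `N`. The load is then half of `min ρ₀ 1`.
  let p : unitInterval := ⟨N⁻¹, by positivity, inv_le_one_of_one_le₀ hN⟩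
  have hp : (p : ℝ) = N⁻¹ := rfl
  have hmean : ∫ s, s ∂bernoulliMeasure N 0 p = 1 := by
    rw [integral_bernoulliMeasure, hp]; simp [hN0.ne']
  have hsq : ∫ s, s ^ 2 ∂bernoulliMeasure N 0 p = N := by
    rw [integral_bernoulliMeasure, hp]; simp; field_simp
  have hmin : 0 < min ρ₀ 1 := lt_min hρ₀ one_pos
  let M : MG1 :=
    { arrivalRate := min ρ₀ 1 / 2
      service := bernoulliMeasure N 0 p
      isProbabilityMeasure_service := inferInstance
      arrivalRate_pos := by positivity
      service_nonneg := by
        rw [ae_iff]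
        refine bernoulliMeasure_apply_of_notMem_of_notMem p ?_ ?_ ?_
        · simp only [not_le]; exact measurableSet_Iio
        · simp [hN0.le]
        · simp
      memLp_service := by
        rw [memLp_two_iff_integrable_sq measurable_id.aestronglyMeasurable]
        exact integrable_bernoulliMeasure _ _ _ _
      mean_pos := by rw [hmean]; exact one_pos
      load_lt_one := by
        rw [hmean]
        linarith [min_le_right ρ₀ 1] }
  refine ⟨M, ?_, ?_⟩
  · change min ρ₀ 1 / 2 / (∫ s, s ∂bernoulliMeasure N 0 p)⁻¹ < ρ₀
    rw [hmean]
    linarith [min_le_left ρ₀ 1]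
  · change K₀ < (∫ s, s ^ 2 ∂bernoulliMeasure N 0 p) *
      (∫ s, s ∂bernoulliMeasure N 0 p)⁻¹ ^ 2
    rw [hmean, hsq]
    simpa using hKN

end MG1

end

theorem theorem2 :
    -- the steady-state expected waiting times exist and are finite
    (∀ (M : MG1) (φ : unitInterval) (c : Bool),
      Tendsto (M.expectedWait φ c) atTop (𝓝 (ENNReal.ofReal (M.meanWait φ c)))) ∧
    -- the price of anarchy is defined and at most 4/3, for every queue and every fee
    (∀ (M : MG1) (C : ℝ), ∃ r : ℝ, M.IsPriceOfAnarchy C r ∧ r ≤ 4 / 3) ∧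
    -- the bound is approached as the load tends to 0 and the variance parameter to infinity
    (∀ ε : ℝ, 0 < ε → ∃ ρ₀ K₀ : ℝ, 0 < ρ₀ ∧
      ∀ M : MG1, M.load < ρ₀ → K₀ < M.varianceParam →
        ∃ C r : ℝ, 0 < C ∧ M.IsPriceOfAnarchy C r ∧ 4 / 3 - ε < r) ∧
    -- the bound is tight
    IsLUB {r : ℝ | ∃ (M : MG1) (C : ℝ), 0 < C ∧ M.IsPriceOfAnarchy C r} (4 / 3) := by
  have happroach : ∀ ε : ℝ, 0 < ε → ∃ ρ₀ K₀ : ℝ, 0 < ρ₀ ∧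
      ∀ M : MG1, M.load < ρ₀ → K₀ < M.varianceParam →
        ∃ C r : ℝ, 0 < C ∧ M.IsPriceOfAnarchy C r ∧ 4 / 3 - ε < r := by
    refine fun ε hε => ⟨ε, 2 + 2 / ε, hε, fun M hρ hK => ?_⟩
    obtain ⟨r, hr⟩ := M.exists_isPriceOfAnarchy M.fcfsWait
    exact ⟨_, r, M.fcfsWait_pos, hr, M.lt_of_isPriceOfAnarchy_fcfsWait hε hρ hK hr⟩
  refine ⟨MG1.tendsto_expectedWait_meanWait, fun M C => ?_, happroach, ?_, fun u hu => ?_⟩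
  · obtain ⟨r, hr⟩ := M.exists_isPriceOfAnarchy C
    exact ⟨r, hr, hr.le_four_thirds⟩
  · rintro r ⟨M, C, -, hr⟩
    exact hr.le_four_thirds
  · by_contra! hlt
    -- With this `ε`, the lower bound `4/3 - ε` is `u` itself.
    obtain ⟨ρ₀, K₀, hρ₀, h⟩ := happroach (4 / 3 - u) (sub_pos.2 hlt)
    obtain ⟨M, hρ, hK⟩ := MG1.exists_load_lt_varianceParam_gt hρ₀ K₀
    obtain ⟨C, r, hC, hr, hlt'⟩ := h M hρ hK
    have := hu ⟨M, C, hC, hr⟩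
    linarith
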